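/- Let $X_{n,k}$ ($n\ge 1$, $0<k<2^n$, $k$ odd) be independent random variables, each uniform on $[0,1]$, on a probability space. Define $\varphi$ on the dyadic rationals of $[0,1]$ by $\varphi(0)=0$, $\varphi(1)=1$ and, successively for $n=1,2,\dots$ and odd $0<k<2^n$, $$\varphi(k2^{-n})=\varphi((k-1)2^{-n})+X_{n,k}\,\bigl(\varphi((k+1)2^{-n})-\varphi((k-1)2^{-n})\bigr).$$ With probability $1$ this function extends (uniquely) to a homeomorphism $\varphi$ of $[0,1]$: the Dubins–Freedman random homeomorphism with base measure uniform on $\{x=\frac12\}$. Let $f$ be a continuous complex-valued function on the circle $\mathbb T=\mathbb R/\mathbb Z$ satisfying $$|f(\delta)-f(0)|=o\Bigl(\bigl(\log\log\log\tfrac1{|\delta|}\bigr)^{-1}\Bigr)\qquad(\delta\to0,\ \text{from both sides}).$$ Then, with probability $1$, the Fourier series of $f\circ\varphi$ (regarded as a function on $\mathbb T$, identified with $[0,1]$ with its endpoints glued) converges at $0$ to $f(\varphi(0))=f(0)$; that is, $$S_n(f\circ\varphi;0)=\sum_{k=-n}^{n}\int_0^1 f(\varphi(t))\,e^{-2\pi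 i k t}\,dt\ \longrightarrow\ f(0)\qquad(n\to\infty).$$ -/

import Mathlib

open Filter Topology MeasureTheory ProbabilityTheory

/-- The values `φ (k / 2 ^ n)` (for `k ≤ 2 ^ n`) produced by the Dubins–Freedman construction with
base measure supported on the line `{x = 1/2}` from the numbers `x n k` (`k` odd, `k < 2 ^ n`):
`φ 0 = 0`, `φ 1 = 1`, and for odd `k`
`φ (k / 2 ^ n) = φ ((k-1) / 2 ^ n) + x n k * (φ ((k+1) / 2 ^ n) - φ ((k-1) / 2 ^ n))`.
For even `k` the point `k / 2 ^ (n+1)` is the point `(k / 2) / 2 ^ n` of the previous level. -/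
noncomputable def dyadicValue (x : ℕ → ℕ → ℝ) : ℕ → ℕ → ℝ
  | 0, k => if k = 0 then 0 else 1
  | n + 1, k =>
    if Even k then dyadicValue x n (k / 2)
    else dyadicValue x n ((k - 1) / 2) +
      x (n + 1) k * (dyadicValue x n ((k + 1) / 2) - dyadicValue x n ((k - 1) / 2))

/-- The homeomorphism `φ` of `[0,1]` extends the function on the dyadic rationals built from `x`.
Dyadic rationals being dense, at most one `φ` does. -/
def IsDubinsFreedman (x : ℕ → ℕ → ℝ) (φ : unitInterval ≃ₜ unitInterval) : Prop :=
  ∀ (n k : ℕ) (t : unitInterval), (t : ℝ) = (k : ℝ) / 2 ^ n → (φ t : ℝ) = dyadicValue x n k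

/-- The function `f ∘ φ` on the circle `ℝ / ℤ`: a point of the circle is represented by
`t ∈ [0,1)`, and mapped to the value of `f` at the class of `φ t ∈ [0,1]` modulo `1`. -/
noncomputable def compHomeo (f : C(UnitAddCircle, ℂ)) (φ : unitInterval ≃ₜ unitInterval) :
    UnitAddCircle → ℂ :=
  AddCircle.liftIco (1 : ℝ) 0
    (fun t : ℝ => f (((φ (Set.projIcc 0 1 zero_le_one t) : unitInterval) : ℝ) : UnitAddCircle))

/-- The symmetric partial sums `S_n (g; x) = ∑_{|k| ≤ n} ĝ(k) e^{2 π i k x}` of the Fourier series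
of a function on the circle. -/
noncomputable def fourierPartialSum (g : UnitAddCircle → ℂ) (n : ℕ) (x : UnitAddCircle) : ℂ :=
  ∑ k ∈ Finset.Icc (-(n : ℤ)) (n : ℤ), fourierCoeff g k * fourier k x

/-!
Subtracting `f 0`, splitting into real and imaginary parts, and reflecting the circle, it suffices to
show that `∫_0^{1/2} h (φ t) D_n (t) dt → 0` almost surely, where `D_n` is the Dirichlet kernel, `h` is
real, `|h| ≤ 1`, `h 0 = 0`, and `h y = o (1 / log log log (1 / y))` as `y → 0+`.

Cut `(0, 1/2]` into the blocks `[2 ^ (-m-1), 2 ^ (-m)]`, and let the frequency be `n ∈ [2 ^ M, 2 ^ (M+1))`.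
On the block `m = M - j` the kernel is at most `2 ^ m`, so each block contributes at most the supremum
of `|h ∘ φ|` there. Almost surely `φ (2 ^ (-m)) ≤ (9 / 10) ^ m` for large `m`
(`ae_eventually_gap_lt`, from the second moments `3 ^ (-n)` of the lengths of images of dyadic
intervals), so the hypothesis on `h` controls the `O (log log M)` blocks with `j ≤ C log log M`,
together with `[0, 2 ^ (-M)]`.

On the other blocks the randomness of `φ` produces cancellation
(`arrayLaw_blockIntegral_le`): with `p = ⌊j / 8⌋`, the block integral is `O (2 ^ (-p))` outside an
event of probability `2 ^ (O (p)) exp (-4 ^ p)`. To see this, cut the block into `2 ^ (4 p)` equal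
cells and condition on all variables except those attached to the midpoints of the cells. The
integrals over the cells are then independent and bounded, so that Hoeffding's inequality applies to
their sum, and what matters is the conditional mean of each. On one half of a cell,
`φ = a + ℓ v ψ` with `v` uniform and `ψ` monotone and fixed. The average of `h (a + ℓ v ψ (t))` over
`v` equals `(ψ t)⁻¹ ∫_0^{ψ t} h (a + ℓ y) dy`, which is of bounded variation in `t` as long as `ψ` is
not too small, whatever `h` is. The second mean value theorem thus yields a bound by the
oscillation of the kernel (`abs_integral_average_dilation_le`). The part of the cell where `ψ` may be
too small is short (`abs_integral_cellIntegral_le`).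

Frequencies closer than `2 ^ (M - 2 j)` give almost the same integral over the block `m = M - j`, so
`2 ^ (O (j))` frequencies suffice for each block. For `j ≥ C log log M` the exceptional probabilities
are then summable over `j` and `M`, and the Borel–Cantelli lemma applies
(`ae_eventually_abs_blockIntegral_le`). The remaining bounds `O (2 ^ (-j / 8))` have a small sum over
`j ≥ C log log M`.
-/

/-! ### Integrals against a kernel of small interval averages -/

/-- A bound for the integral of `w` over all subintervals of `[a, b]` holds for the integral over
any order-connected subset, since such a set is an interval up to its endpoints. -/
lemma abs_setIntegral_le_of_ordConnected {w : ℝ → ℝ} {a b K : ℝ} (hab : a ≤ b)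
    (hK : ∀ c d, a ≤ c → c ≤ d → d ≤ b → |∫ t in c..d, w t| ≤ K) {E : Set ℝ}
    (hE : E.OrdConnected) (hsub : E ⊆ Set.Icc a b) : |∫ t in E, w t| ≤ K := by
  rcases E.eq_empty_or_nonempty with rfl | hne
  · simpa using hK a a le_rfl le_rfl hab
  have hbb : BddBelow E := bddBelow_Icc.mono hsub
  have hba : BddAbove E := bddAbove_Icc.mono hsub
  have h1 : E ⊆ Set.Icc (sInf E) (sSup E) := fun x hx => ⟨csInf_le hbb hx, le_csSup hba hx⟩
  have h2 : Set.Ioo (sInf E) (sSup E) ⊆ E := by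
    rintro x ⟨hx1, hx2⟩
    obtain ⟨y, hy, hyx⟩ := exists_lt_of_csInf_lt hne hx1
    obtain ⟨z, hz, hxz⟩ := exists_lt_of_lt_csSup hne hx2
    exact hE.out hy hz ⟨hyx.le, hxz.le⟩
  have hcd : sInf E ≤ sSup E := csInf_le_csSup hne hbb hba
  have h3 : E =ᵐ[volume] Set.Ioc (sInf E) (sSup E) := by
    refine Filter.EventuallyLE.antisymm ?_ ?_
    · exact (LE.le.eventuallyLE h1).trans (Ioc_ae_eq_Icc (μ := volume)).symm.le
    · exact (Ioo_ae_eq_Ioc (μ := volume)).symm.le.trans (LE.le.eventuallyLE h2)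
  rw [setIntegral_congr_set h3, ← intervalIntegral.integral_of_le hcd]
  exact hK _ _ (le_csInf hne fun x hx => (hsub hx).1) hcd (csSup_le hne fun x hx => (hsub hx).2)

/-- A form of the second mean value theorem, for a weight `B` with order-connected superlevel
sets: `B` is a superposition of indicators of these sets. -/
lemma abs_setIntegral_mul_le_of_ordConnected {w B : ℝ → ℝ} {a b K C : ℝ} (hab : a ≤ b)
    (hC : 0 ≤ C)
    (hK : ∀ c d, a ≤ c → c ≤ d → d ≤ b → |∫ t in c..d, w t| ≤ K)
    (hw : IntegrableOn w (Set.Icc a b)) (hB : Measurable B)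
    (hB0 : ∀ t ∈ Set.Icc a b, 0 ≤ B t) (hBC : ∀ t ∈ Set.Icc a b, B t ≤ C)
    (hconn : ∀ s, 0 ≤ s → Set.OrdConnected {t | t ∈ Set.Icc a b ∧ s < B t}) :
    |∫ t in Set.Icc a b, B t * w t| ≤ C * K := by
  set μ := volume.restrict (Set.Icc a b) with hμ
  set ν := volume.restrict (Set.Ioo 0 C) with hν
  have hSm : MeasurableSet {p : ℝ × ℝ | p.2 < B p.1} :=
    measurableSet_lt measurable_snd (hB.comp measurable_fst)
  have hlayer : ∀ t ∈ Set.Icc a b,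
      B t * w t = ∫ s, (Set.indicator {p : ℝ × ℝ | p.2 < B p.1} (fun _ => (1:ℝ)) (t, s)) * w t ∂ν := by
    intro t ht
    rw [integral_mul_const]
    congr 1
    have : (fun s => Set.indicator {p : ℝ × ℝ | p.2 < B p.1} (fun _ => (1:ℝ)) (t, s))
        = Set.indicator (Set.Iio (B t)) (fun _ => (1:ℝ)) := by
      ext s; simp [Set.indicator]
    rw [this, integral_indicator measurableSet_Iio, hν, Measure.restrict_restrict measurableSet_Iio]
    have h2 : Set.Iio (B t) ∩ Set.Ioo 0 C = Set.Ioo 0 (B t) := by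
      ext s
      simp only [Set.mem_inter_iff, Set.mem_Iio, Set.mem_Ioo]
      have := hBC t ht
      constructor
      · rintro ⟨h1, h2, h3⟩; exact ⟨h2, h1⟩
      · rintro ⟨h1, h2⟩; exact ⟨h2, h1, h2.trans_le this⟩
    rw [h2]
    simp [hB0 t ht]
  rw [setIntegral_congr_fun measurableSet_Icc hlayer]
  have hint : Integrable (Function.uncurry fun t s : ℝ =>
      (Set.indicator {p : ℝ × ℝ | p.2 < B p.1} (fun _ => (1:ℝ)) (t, s)) * w t) (μ.prod ν) := by
    have h1 : Integrable (fun p : ℝ × ℝ => w p.1) (μ.prod ν) := Integrable.comp_fst hw ν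
    refine Integrable.mono h1 ?_ ?_
    · refine AEStronglyMeasurable.mul ?_ h1.aestronglyMeasurable
      exact (measurable_const.indicator hSm).aestronglyMeasurable
    · refine ae_of_all _ fun p => ?_
      simp only [Function.uncurry, Prod.mk.eta, norm_mul]
      refine mul_le_of_le_one_left (norm_nonneg _) ?_
      by_cases hp : p ∈ {p : ℝ × ℝ | p.2 < B p.1}
      · simp [Set.indicator_of_mem hp]
      · simp [Set.indicator_of_notMem hp]
  rw [integral_integral_swap hint]
  have hbound : ∀ s ∈ Set.Ioo 0 C, ‖∫ t, (Set.indicator {p : ℝ × ℝ | p.2 < B p.1}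
      (fun _ => (1:ℝ)) (t, s)) * w t ∂μ‖ ≤ K := by
    intro s hs
    have h1 : (fun t => (Set.indicator {p : ℝ × ℝ | p.2 < B p.1} (fun _ => (1:ℝ)) (t, s)) * w t)
        = Set.indicator {t | s < B t} w := by
      ext t; by_cases h : s < B t <;> simp [Set.indicator, h]
    have hm : MeasurableSet {t | s < B t} := measurableSet_lt measurable_const hB
    rw [h1, integral_indicator hm, hμ, Measure.restrict_restrict hm, Real.norm_eq_abs]
    refine abs_setIntegral_le_of_ordConnected hab hK ?_ Set.inter_subset_right
    convert hconn s hs.1.le using 1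
    ext t; simp [and_comm]
  calc _ ≤ K * volume.real (Set.Ioo 0 C) :=
        norm_setIntegral_le_of_norm_le_const (by simp) hbound
    _ = C * K := by simp [hC, mul_comm]

lemma integral_inv_max {δ : ℝ} (hδ : 0 < δ) (hδ1 : δ ≤ 1) :
    ∫ y in (0:ℝ)..1, (max y δ)⁻¹ = 1 + Real.log (1 / δ) := by
  have hc : Continuous fun y : ℝ => (max y δ)⁻¹ :=
    (continuous_id.max continuous_const).inv₀ fun y => (lt_max_of_lt_right hδ).ne'
  rw [← intervalIntegral.integral_add_adjacent_intervals (hc.intervalIntegrable 0 δ)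
    (hc.intervalIntegrable δ 1)]
  congr 1
  · rw [intervalIntegral.integral_congr (g := fun _ => δ⁻¹)]
    · simp [hδ.ne']
    · intro y hy
      rw [Set.uIcc_of_le hδ.le] at hy
      simp [max_eq_right hy.2]
  · rw [intervalIntegral.integral_congr (g := fun y => y⁻¹), integral_inv_of_pos hδ one_pos]
    intro y hy
    rw [Set.uIcc_of_le hδ1] at hy
    simp [max_eq_left hy.1]

/-- Averaging a bounded function `H` over dilations by a uniform `v ∈ [0, 1]` makes
`t ↦ H (v ψ t)` regular for monotone `ψ ≥ δ`: its integral against a kernel `w` with interval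
averages at most `K` is `O (K (1 + log (1 / δ)))`. Indeed the substitution `y = v ψ t` turns the
average into `∫ H y (∫_{ψ ≥ y} w / ψ) dy`, to which the second mean value theorem applies. -/
lemma abs_integral_average_dilation_le {w ψ H : ℝ → ℝ} {a b K δ : ℝ} (hab : a ≤ b)
    (hδ : 0 < δ) (hK : ∀ c d, a ≤ c → c ≤ d → d ≤ b → |∫ t in c..d, w t| ≤ K)
    (hw : IntegrableOn w (Set.Icc a b)) (hψm : Measurable ψ)
    (hψ : MonotoneOn ψ (Set.Icc a b) ∨ AntitoneOn ψ (Set.Icc a b))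
    (hψδ : ∀ t ∈ Set.Icc a b, δ ≤ ψ t) (hψ1 : ∀ t ∈ Set.Icc a b, ψ t ≤ 1)
    (hH : Measurable H) (hH1 : ∀ y, |H y| ≤ 1) :
    |∫ v in Set.Icc (0:ℝ) 1, ∫ t in Set.Icc a b, H (v * ψ t) * w t|
      ≤ K * (1 + Real.log (1 / δ)) := by
  set μ := volume.restrict (Set.Icc a b) with hμ
  have hK0 : 0 ≤ K := (abs_nonneg _).trans (hK a a le_rfl le_rfl hab)
  have hδ1 : δ ≤ 1 := (hψδ a ⟨le_rfl, hab⟩).trans (hψ1 a ⟨le_rfl, hab⟩)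
  have hint1 : Integrable (Function.uncurry fun v t : ℝ => H (v * ψ t) * w t)
      ((volume.restrict (Set.Icc (0:ℝ) 1)).prod μ) := by
    have h1 : Integrable (fun p : ℝ × ℝ => w p.2) ((volume.restrict (Set.Icc (0:ℝ) 1)).prod μ) :=
      Integrable.comp_snd hw _
    refine h1.bdd_mul (c := 1) ?_ ?_
    · exact (hH.comp (measurable_fst.mul (hψm.comp measurable_snd))).aestronglyMeasurable
    · exact ae_of_all _ fun p => hH1 _
  rw [integral_integral_swap hint1]
  have hinner : ∀ t ∈ Set.Icc a b, ∫ v in Set.Icc (0:ℝ) 1, H (v * ψ t) * w t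
      = ∫ y in Set.Ioc (0:ℝ) 1,
        H y * (Set.indicator {p : ℝ × ℝ | p.2 ≤ ψ p.1} (fun p => (ψ p.1)⁻¹) (t, y) * w t) := by
    intro t ht
    have hpos : 0 < ψ t := hδ.trans_le (hψδ t ht)
    rw [integral_mul_const, integral_Icc_eq_integral_Ioc, ← intervalIntegral.integral_of_le zero_le_one,
      intervalIntegral.integral_comp_mul_right _ hpos.ne']
    have : (fun y => H y * (Set.indicator {p : ℝ × ℝ | p.2 ≤ ψ p.1} (fun p => (ψ p.1)⁻¹) (t, y) * w t))
        = fun y => ((ψ t)⁻¹ * w t) * Set.indicator (Set.Iic (ψ t)) H y := by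
      ext y; by_cases h : y ≤ ψ t
      · simp [Set.indicator, h]; ring
      · simp [Set.indicator, h]
    rw [this, integral_const_mul, integral_indicator measurableSet_Iic,
      Measure.restrict_restrict measurableSet_Iic]
    have h2 : Set.Iic (ψ t) ∩ Set.Ioc 0 1 = Set.Ioc 0 (ψ t) := by
      ext s
      simp only [Set.mem_inter_iff, Set.mem_Iic, Set.mem_Ioc]
      have := hψ1 t ht
      constructor
      · rintro ⟨h1, h2, h3⟩; exact ⟨h2, h1⟩
      · rintro ⟨h1, h2⟩; exact ⟨h2, h1, h2.trans this⟩
    rw [h2, zero_mul, one_mul, intervalIntegral.integral_of_le hpos.le, smul_eq_mul]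
    ring
  rw [setIntegral_congr_fun measurableSet_Icc hinner]
  have hSm : MeasurableSet {p : ℝ × ℝ | p.2 ≤ ψ p.1} :=
    measurableSet_le measurable_snd (hψm.comp measurable_fst)
  have hint2 : Integrable (Function.uncurry fun t y : ℝ =>
      H y * (Set.indicator {p : ℝ × ℝ | p.2 ≤ ψ p.1} (fun p => (ψ p.1)⁻¹) (t, y) * w t))
      (μ.prod (volume.restrict (Set.Ioc (0:ℝ) 1))) := by
    have h1 : Integrable (fun p : ℝ × ℝ => w p.1) (μ.prod (volume.restrict (Set.Ioc (0:ℝ) 1))) :=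
      Integrable.comp_fst hw _
    refine (h1.bdd_mul (c := δ⁻¹) ?_ ?_).bdd_mul (c := 1) ?_ ?_
    · exact (((hψm.comp measurable_fst).inv).indicator hSm).aestronglyMeasurable
    · have : ∀ᵐ p ∂(μ.prod (volume.restrict (Set.Ioc (0:ℝ) 1))), p.1 ∈ Set.Icc a b :=
        Measure.quasiMeasurePreserving_fst.ae (ae_restrict_mem measurableSet_Icc)
      filter_upwards [this] with p hp
      have h3 := hψδ _ hp
      have h4 : (ψ p.1)⁻¹ ≤ δ⁻¹ := inv_anti₀ hδ h3
      have h5 : 0 < ψ p.1 := hδ.trans_le h3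
      by_cases h : p.2 ≤ ψ p.1
      · simp [Set.indicator, h, abs_of_pos h5, h4]
      · simp [Set.indicator, h, hδ.le]
    · exact (hH.comp measurable_snd).aestronglyMeasurable
    · exact ae_of_all _ fun p => hH1 _
  rw [integral_integral_swap hint2]
  have hbound : ∀ y ∈ Set.Ioc (0:ℝ) 1, ‖∫ t, H y *
      (Set.indicator {p : ℝ × ℝ | p.2 ≤ ψ p.1} (fun p => (ψ p.1)⁻¹) (t, y) * w t) ∂μ‖
      ≤ (max y δ)⁻¹ * K := by
    intro y hy
    rw [integral_const_mul, norm_mul]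
    refine (mul_le_of_le_one_left (norm_nonneg _) (hH1 y)).trans ?_
    have hB : Measurable fun t => Set.indicator {p : ℝ × ℝ | p.2 ≤ ψ p.1} (fun p => (ψ p.1)⁻¹) (t, y) :=
      (((hψm.comp measurable_fst).inv).indicator hSm).comp (measurable_id.prodMk measurable_const)
    have hBe : ∀ t, Set.indicator {p : ℝ × ℝ | p.2 ≤ ψ p.1} (fun p => (ψ p.1)⁻¹) (t, y)
        = if y ≤ ψ t then (ψ t)⁻¹ else 0 := by
      intro t; simp [Set.indicator]
    have hmax : 0 < max y δ := lt_max_of_lt_right hδ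
    refine abs_setIntegral_mul_le_of_ordConnected hab (inv_nonneg.2 hmax.le) hK hw hB ?_ ?_ ?_
    · intro t ht
      rw [hBe]
      have h5 : 0 < ψ t := hδ.trans_le (hψδ t ht)
      split_ifs <;> positivity
    · intro t ht
      rw [hBe]
      split_ifs with h
      · exact inv_anti₀ hmax (max_le h (hψδ t ht))
      · positivity
    · intro s hs
      have hset : {t | t ∈ Set.Icc a b ∧ s < Set.indicator {p : ℝ × ℝ | p.2 ≤ ψ p.1}
          (fun p => (ψ p.1)⁻¹) (t, y)} = {t | t ∈ Set.Icc a b ∧ y ≤ ψ t ∧ s < (ψ t)⁻¹} := by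
        ext t
        simp only [hBe, Set.mem_ofPred_eq]
        refine and_congr_right fun ht => ?_
        split_ifs with h
        · simp [h]
        · simp [h, hs]
      rw [hset]
      constructor
      rintro p ⟨hp, hp1, hp2⟩ q ⟨hq, hq1, hq2⟩ t ⟨ht1, ht2⟩
      have ht : t ∈ Set.Icc a b := ⟨hp.1.trans ht1, ht2.trans hq.2⟩
      have ht0 : 0 < ψ t := hδ.trans_le (hψδ t ht)
      rcases hψ with hψ | hψ
      · exact ⟨ht, hp1.trans (hψ hp ht ht1), hq2.trans_le (inv_anti₀ ht0 (hψ ht hq ht2))⟩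
      · exact ⟨ht, hq1.trans (hψ ht hq ht2), hp2.trans_le (inv_anti₀ ht0 (hψ hp ht ht1))⟩
  have hc : Continuous fun y : ℝ => (max y δ)⁻¹ * K :=
    ((continuous_id.max continuous_const).inv₀ fun y => (lt_max_of_lt_right hδ).ne').mul_const K
  rw [← Real.norm_eq_abs]
  calc _ ≤ ∫ y in Set.Ioc (0:ℝ) 1, (max y δ)⁻¹ * K := by
        refine norm_integral_le_of_norm_le ?_ ?_
        · exact (hc.integrableOn_Ioc (a := 0) (b := 1))
        · exact (ae_restrict_mem measurableSet_Ioc).mono fun y hy => hbound y hy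
    _ = K * (1 + Real.log (1 / δ)) := by
        rw [← intervalIntegral.integral_of_le zero_le_one, intervalIntegral.integral_mul_const,
          integral_inv_max hδ hδ1, mul_comm]

/-! ### The Dirichlet kernel -/

/-- The Dirichlet kernel `D_n (t) = ∑_{|k| ≤ n} e^{2 π i k t} = 1 + 2 ∑_{k = 1}^n cos (2 π k t)`. -/
noncomputable def dirichletKer (n : ℕ) (t : ℝ) : ℝ :=
  1 + 2 * ∑ k ∈ Finset.range n, Real.cos (2 * Real.pi * (k + 1) * t)

lemma continuous_dirichletKer (n : ℕ) : Continuous (dirichletKer n) := by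
  unfold dirichletKer; fun_prop

lemma dirichletKer_mul_sin (n : ℕ) (t : ℝ) :
    dirichletKer n t * Real.sin (Real.pi * t) = Real.sin ((2 * n + 1) * (Real.pi * t)) := by
  induction n with
  | zero => simp [dirichletKer]
  | succ n ih =>
    have h : dirichletKer (n + 1) t
        = dirichletKer n t + 2 * Real.cos (2 * Real.pi * (n + 1) * t) := by
      simp only [dirichletKer, Finset.sum_range_succ]; ring
    rw [h, add_mul, ih]
    have e1 : (2 * n + 1) * (Real.pi * t) = 2 * Real.pi * (n + 1) * t - Real.pi * t := by ring
    have e2 : (2 * ((n + 1 : ℕ) : ℝ) + 1) * (Real.pi * t)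
        = 2 * Real.pi * (n + 1) * t + Real.pi * t := by push_cast; ring
    rw [e1, e2, Real.sin_sub, Real.sin_add]
    ring

lemma dirichletKer_one_sub (n : ℕ) (t : ℝ) : dirichletKer n (1 - t) = dirichletKer n t := by
  unfold dirichletKer
  congr 2
  refine Finset.sum_congr rfl fun k _ => ?_
  have : 2 * Real.pi * (k + 1) * (1 - t)
      = ((k + 1 : ℕ) : ℝ) * (2 * Real.pi) - 2 * Real.pi * (k + 1) * t := by push_cast; ring
  rw [this, Real.cos_nat_mul_two_pi_sub]

lemma abs_dirichletKer_sub_le {m n : ℕ} (h : m ≤ n) (t : ℝ) :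
    |dirichletKer n t - dirichletKer m t| ≤ 2 * (n - m) := by
  obtain ⟨l, rfl⟩ := Nat.exists_eq_add_of_le h
  have e : dirichletKer (m + l) t - dirichletKer m t
      = 2 * ∑ k ∈ Finset.range l, Real.cos (2 * Real.pi * ((m + k : ℕ) + 1) * t) := by
    unfold dirichletKer
    rw [Finset.sum_range_add]; ring
  rw [e, abs_mul, abs_two]
  have := Finset.abs_sum_le_sum_abs (fun k : ℕ => Real.cos (2 * Real.pi * ((m + k : ℕ) + 1) * t))
    (Finset.range l)
  have h2 : ∑ k ∈ Finset.range l, |Real.cos (2 * Real.pi * ((m + k : ℕ) + 1) * t)| ≤ l := by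
    refine (Finset.sum_le_sum fun k _ => Real.abs_cos_le_one _).trans (by simp)
  push_cast at *
  linarith

lemma abs_dirichletKer_le (n : ℕ) (t : ℝ) : |dirichletKer n t| ≤ 2 * n + 1 := by
  have h := abs_dirichletKer_sub_le (Nat.zero_le n) t
  have h0 : dirichletKer 0 t = 1 := by simp [dirichletKer]
  rw [h0, abs_le] at h
  rw [abs_le]
  constructor <;> push_cast at h <;> linarith [h.1, h.2]

/-- Jordan's inequality on `(0, 1/2]`, the left half of the circle. -/
lemma two_mul_le_sin_pi_mul {t : ℝ} (h0 : 0 ≤ t) (h1 : t ≤ 1 / 2) :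
    2 * t ≤ Real.sin (Real.pi * t) := by
  have h := Real.mul_le_sin (x := Real.pi * t) (by positivity)
    (by nlinarith [Real.pi_pos])
  have e : 2 / Real.pi * (Real.pi * t) = 2 * t := by field_simp
  linarith

lemma abs_dirichletKer_le_inv (n : ℕ) {t : ℝ} (h0 : 0 < t) (h1 : t ≤ 1 / 2) :
    |dirichletKer n t| ≤ (2 * t)⁻¹ := by
  have hs := two_mul_le_sin_pi_mul h0.le h1
  have h2 : 0 < 2 * t := by positivity
  have h3 : 0 < Real.sin (Real.pi * t) := h2.trans_le hs
  have e := congrArg abs (dirichletKer_mul_sin n t)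
  rw [abs_mul, abs_of_pos h3] at e
  have h4 : |dirichletKer n t| * (2 * t) ≤ 1 := by
    calc _ ≤ |dirichletKer n t| * Real.sin (Real.pi * t) := by gcongr
      _ ≤ 1 := by rw [e]; exact Real.abs_sin_le_one _
  rw [inv_eq_one_div, le_div_iff₀ h2]
  exact h4

/-- Cancellation in the Dirichlet kernel away from `0`. -/
lemma abs_integral_dirichletKer_le (n : ℕ) {c d : ℝ} (h0 : 0 < c) (hcd : c ≤ d) (h1 : d ≤ 1 / 2) :
    |∫ t in c..d, dirichletKer n t| ≤ (c * (2 * n + 1))⁻¹ := by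
  have hN : (0:ℝ) < 2 * n + 1 := by positivity
  set B : ℝ → ℝ := fun t => (Real.sin (Real.pi * t))⁻¹ with hB
  set w : ℝ → ℝ := fun t => Real.sin ((2 * n + 1) * (Real.pi * t)) with hw
  have hwc : Continuous w := by simp only [hw]; fun_prop
  have hpos : ∀ t ∈ Set.Icc c d, 2 * c ≤ Real.sin (Real.pi * t) := fun t ht =>
    le_trans (by linarith [ht.1]) (two_mul_le_sin_pi_mul (h0.le.trans ht.1) (ht.2.trans h1))
  have hanti : AntitoneOn B (Set.Icc c d) := by
    intro s hs t ht hst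
    refine inv_anti₀ (by linarith [hpos s hs]) ?_
    refine Real.sin_le_sin_of_le_of_le_pi_div_two ?_ ?_ ?_
    · have : 0 ≤ Real.pi * s := by have := Real.pi_pos; have := h0.le.trans hs.1; positivity
      linarith [Real.pi_pos]
    · nlinarith [Real.pi_pos, ht.2]
    · have := Real.pi_pos; gcongr
  have e : ∫ t in c..d, dirichletKer n t = ∫ t in Set.Icc c d, B t * w t := by
    rw [intervalIntegral.integral_of_le hcd, ← integral_Icc_eq_integral_Ioc]
    refine setIntegral_congr_fun measurableSet_Icc fun t ht => ?_
    have := hpos t ht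
    have h3 : Real.sin (Real.pi * t) ≠ 0 := by linarith
    simp only [hB, hw]
    rw [← dirichletKer_mul_sin]
    field_simp
  have hK : ∀ x y, c ≤ x → x ≤ y → y ≤ d → |∫ t in x..y, w t| ≤ 2 * (2 * (n:ℝ) + 1)⁻¹ * Real.pi⁻¹ := by
    intro x y _ _ _
    have e2 : ∀ t, w t = Real.sin (((2 * n + 1) * Real.pi) * t) := fun t => by
      simp only [hw]; congr 1; ring
    have hne : (2 * n + 1) * Real.pi ≠ 0 := by positivity
    simp_rw [e2]
    rw [intervalIntegral.integral_comp_mul_left (fun t => Real.sin t) hne, integral_sin, smul_eq_mul, abs_mul,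
      abs_of_pos (by positivity), mul_inv]
    have h3 := Real.abs_cos_le_one ((2 * n + 1) * Real.pi * x)
    have h4 := Real.abs_cos_le_one ((2 * n + 1) * Real.pi * y)
    have h5 : |Real.cos ((2 * n + 1) * Real.pi * x) - Real.cos ((2 * n + 1) * Real.pi * y)| ≤ 2 :=
      (abs_sub _ _).trans (by linarith)
    calc _ ≤ (2 * (n:ℝ) + 1)⁻¹ * Real.pi⁻¹ * 2 := by gcongr
      _ = _ := by ring
  have key := abs_setIntegral_mul_le_of_ordConnected (w := w) (B := B) (C := (2 * c)⁻¹) hcd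
    (by positivity) hK (hwc.integrableOn_Icc)
    (by simp only [hB]; exact (by fun_prop : Measurable fun t => Real.sin (Real.pi * t)).inv)
    (fun t ht => inv_nonneg.2 (by linarith [hpos t ht]))
    (fun t ht => inv_anti₀ (by positivity) (hpos t ht))
    (by
      intro s hs
      constructor
      rintro p ⟨hp, hp1⟩ q ⟨hq, hq1⟩ t ⟨ht1, ht2⟩
      have ht : t ∈ Set.Icc c d := ⟨hp.1.trans ht1, ht2.trans hq.2⟩
      exact ⟨ht, hq1.trans_le (hanti ht hq ht2)⟩)
  rw [e]
  refine key.trans ?_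
  have hpi : Real.pi⁻¹ ≤ 1 := inv_le_one_of_one_le₀ (by linarith [Real.pi_gt_three])
  calc (2 * c)⁻¹ * (2 * (2 * (n:ℝ) + 1)⁻¹ * Real.pi⁻¹)
      ≤ (2 * c)⁻¹ * (2 * (2 * (n:ℝ) + 1)⁻¹ * 1) := by gcongr
    _ = (c * (2 * n + 1))⁻¹ := by field_simp

lemma integral_dirichletKer (n : ℕ) : ∫ t in (0:ℝ)..1, dirichletKer n t = 1 := by
  unfold dirichletKer
  rw [intervalIntegral.integral_add (by simp) (by apply Continuous.intervalIntegrable; fun_prop),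
    intervalIntegral.integral_const_mul, intervalIntegral.integral_finsetSum
      (fun k _ => by apply Continuous.intervalIntegrable; fun_prop)]
  have : ∀ k ∈ Finset.range n, ∫ t in (0:ℝ)..1, Real.cos (2 * Real.pi * (k + 1) * t) = 0 := by
    intro k _
    have hne : 2 * Real.pi * ((k:ℝ) + 1) ≠ 0 := by positivity
    rw [intervalIntegral.integral_comp_mul_left (fun t => Real.cos t) hne, integral_cos]
    have : 2 * Real.pi * ((k:ℝ) + 1) * 1 = ((2 * (k + 1) : ℕ) : ℝ) * Real.pi := by push_cast; ring
    rw [this, Real.sin_nat_mul_pi]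
    simp
  rw [Finset.sum_eq_zero this]
  simp

/-! ### The dyadic construction -/

section Dyadic

variable {x : ℕ → ℕ → ℝ}

lemma dyadicValue_even (x : ℕ → ℕ → ℝ) (n k : ℕ) :
    dyadicValue x (n + 1) (2 * k) = dyadicValue x n k := by
  simp [dyadicValue]

lemma dyadicValue_odd (x : ℕ → ℕ → ℝ) (n k : ℕ) :
    dyadicValue x (n + 1) (2 * k + 1) = dyadicValue x n k +
      x (n + 1) (2 * k + 1) * (dyadicValue x n (k + 1) - dyadicValue x n k) := by
  have h1 : ¬ Even (2 * k + 1) := by simp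
  have h2 : (2 * k + 1 - 1) / 2 = k := by omega
  have h3 : (2 * k + 1 + 1) / 2 = k + 1 := by omega
  rw [dyadicValue, if_neg h1, h2, h3]

lemma dyadicValue_zero_right (x : ℕ → ℕ → ℝ) (n : ℕ) : dyadicValue x n 0 = 0 := by
  induction n with
  | zero => simp [dyadicValue]
  | succ n ih => simpa [ih] using dyadicValue_even x n 0

lemma dyadicValue_of_two_pow_le (x : ℕ → ℕ → ℝ) {n k : ℕ} (h : 2 ^ n ≤ k) :
    dyadicValue x n k = 1 := by
  induction n generalizing k with
  | zero => simp at h; simp [dyadicValue]; omega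
  | succ n ih =>
    rw [pow_succ] at h
    obtain ⟨j, rfl | rfl⟩ := Nat.even_or_odd' k
    · rw [dyadicValue_even, ih (by omega)]
    · rw [dyadicValue_odd, ih (by omega), ih (by omega)]; simp

lemma dyadicValue_congr {y : ℕ → ℕ → ℝ} (h : ∀ n k, Odd k → k < 2 ^ n → x n k = y n k)
    {n k : ℕ} (hk : k ≤ 2 ^ n) : dyadicValue x n k = dyadicValue y n k := by
  induction n generalizing k with
  | zero => simp [dyadicValue]
  | succ n ih =>
    rw [pow_succ] at hk
    obtain ⟨j, rfl | rfl⟩ := Nat.even_or_odd' k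
    · rw [dyadicValue_even, dyadicValue_even, ih (by omega)]
    · rw [dyadicValue_odd, dyadicValue_odd, ih (by omega), ih (by omega),
        h (n + 1) (2 * j + 1) (by simp) (by rw [pow_succ]; omega)]

lemma dyadicValue_mono (hx : ∀ n k, x n k ∈ Set.Icc (0:ℝ) 1) (n : ℕ) :
    Monotone (dyadicValue x n) := by
  induction n with
  | zero =>
    refine monotone_nat_of_le_succ fun k => ?_
    simp only [dyadicValue]; split_ifs <;> simp_all
  | succ n ih =>
    refine monotone_nat_of_le_succ fun k => ?_
    obtain ⟨j, rfl | rfl⟩ := Nat.even_or_odd' k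
    · rw [dyadicValue_even, dyadicValue_odd]
      have := ih (Nat.le_succ j)
      nlinarith [(hx (n + 1) (2 * j + 1)).1]
    · rw [dyadicValue_odd, show 2 * j + 1 + 1 = 2 * (j + 1) by ring, dyadicValue_even]
      have := ih (Nat.le_succ j)
      nlinarith [(hx (n + 1) (2 * j + 1)).2]

lemma dyadicValue_nonneg (hx : ∀ n k, x n k ∈ Set.Icc (0:ℝ) 1) (n k : ℕ) :
    0 ≤ dyadicValue x n k := by
  simpa [dyadicValue_zero_right] using dyadicValue_mono hx n (Nat.zero_le k)

lemma dyadicValue_le_one (hx : ∀ n k, x n k ∈ Set.Icc (0:ℝ) 1) (n k : ℕ) :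
    dyadicValue x n k ≤ 1 := by
  have h := dyadicValue_mono hx n (le_max_left k (2 ^ n))
  rwa [dyadicValue_of_two_pow_le x (le_max_right k (2 ^ n))] at h

/-- The array driving the construction inside the dyadic interval `[k / 2 ^ r, (k + 1) / 2 ^ r]`,
rescaled to `[0, 1]`. -/
def subtree (x : ℕ → ℕ → ℝ) (r k : ℕ) : ℕ → ℕ → ℝ := fun n j => x (r + n) (k * 2 ^ n + j)

/-- Self-similarity of the dyadic construction. -/
lemma dyadicValue_subtree (x : ℕ → ℕ → ℝ) (r k n : ℕ) {j : ℕ} (hj : j ≤ 2 ^ n) :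
    dyadicValue x (r + n) (k * 2 ^ n + j) = dyadicValue x r k +
      (dyadicValue x r (k + 1) - dyadicValue x r k) * dyadicValue (subtree x r k) n j := by
  induction n generalizing j with
  | zero =>
    rcases Nat.le_one_iff_eq_zero_or_eq_one.1 (by simpa using hj) with rfl | rfl <;>
      simp [dyadicValue]
  | succ n ih =>
    rw [pow_succ] at hj
    obtain ⟨i, rfl | rfl⟩ := Nat.even_or_odd' j
    · rw [dyadicValue_even, ← ih (by omega), ← dyadicValue_even x (r + n)]
      congr 1; ring
    · have e : k * 2 ^ (n + 1) + (2 * i + 1) = 2 * (k * 2 ^ n + i) + 1 := by ring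
      rw [← add_assoc, e, dyadicValue_odd, dyadicValue_odd, ih (by omega),
        add_assoc (k * 2 ^ n) i 1, ih (by omega)]
      simp only [subtree]
      rw [← add_assoc r n 1, e]
      ring

lemma pow_le_dyadicValue_one {θ : ℝ} (hθ : 0 ≤ θ) (q : ℕ)
    (h : ∀ i ∈ Finset.Icc 1 q, θ ≤ x i 1) : θ ^ q ≤ dyadicValue x q 1 := by
  induction q with
  | zero => simp [dyadicValue]
  | succ q ih =>
    have h1 := ih fun i hi => h i (Finset.Icc_subset_Icc_right (Nat.le_succ q) hi)
    have h2 := h (q + 1) (by simp)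
    have h3 := dyadicValue_odd x q 0
    simp only [mul_zero, zero_add, dyadicValue_zero_right, sub_zero] at h3
    rw [h3, pow_succ, mul_comm]
    exact mul_le_mul h2 h1 (by positivity) (hθ.trans h2)

lemma pow_le_one_sub_dyadicValue {θ : ℝ} (hθ : 0 ≤ θ) (q : ℕ)
    (h : ∀ i ∈ Finset.Icc 1 q, x i (2 ^ i - 1) ≤ 1 - θ) :
    θ ^ q ≤ 1 - dyadicValue x q (2 ^ q - 1) := by
  induction q with
  | zero => simp [dyadicValue]
  | succ q ih =>
    have h1 := ih fun i hi => h i (Finset.Icc_subset_Icc_right (Nat.le_succ q) hi)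
    have h2 := h (q + 1) (by simp)
    have hq := Nat.one_le_two_pow (n := q)
    have e : 2 ^ (q + 1) - 1 = 2 * (2 ^ q - 1) + 1 := by rw [pow_succ]; omega
    rw [e] at h2 ⊢
    rw [dyadicValue_odd, Nat.sub_add_cancel hq, dyadicValue_of_two_pow_le x le_rfl, pow_succ]
    calc θ ^ q * θ ≤ (1 - dyadicValue x q (2 ^ q - 1)) * (1 - x (q + 1) (2 * (2 ^ q - 1) + 1)) :=
          mul_le_mul h1 (by linarith) hθ ((pow_nonneg hθ q).trans h1)
      _ = _ := by ring

/-! ### The increasing function determined by its dyadic values -/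

/-- The increasing function on `[0, 1]` obtained from the dyadic values: its value at `t` is the
supremum of the values at the dyadic points `⌊2 ^ n t⌋ / 2 ^ n`. It is defined for every array and
jointly measurable, and it is continuous for almost every array. -/
noncomputable def dyadicMap (x : ℕ → ℕ → ℝ) (t : ℝ) : ℝ :=
  ⨆ n : ℕ, dyadicValue x n ⌊2 ^ n * t⌋₊

lemma bddAbove_range_dyadicValue (hx : ∀ n k, x n k ∈ Set.Icc (0:ℝ) 1) (k : ℕ → ℕ) :
    BddAbove (Set.range fun n => dyadicValue x n (k n)) :=
  ⟨1, by rintro _ ⟨n, rfl⟩; exact dyadicValue_le_one hx n _⟩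

lemma dyadicValue_floor_le (hx : ∀ n k, x n k ∈ Set.Icc (0:ℝ) 1) (n : ℕ) (t : ℝ) :
    dyadicValue x n ⌊2 ^ n * t⌋₊ ≤ dyadicMap x t :=
  le_ciSup (bddAbove_range_dyadicValue hx fun n => ⌊2 ^ n * t⌋₊) n

lemma monotone_dyadicValue_floor (hx : ∀ n k, x n k ∈ Set.Icc (0:ℝ) 1) (t : ℝ) :
    Monotone fun n : ℕ => dyadicValue x n ⌊2 ^ n * t⌋₊ := by
  refine monotone_nat_of_le_succ fun n => ?_
  rw [← dyadicValue_even]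
  refine dyadicValue_mono hx _ ?_
  rcases le_or_gt 0 t with ht | ht
  · refine Nat.le_floor ?_
    have := Nat.floor_le (a := 2 ^ n * t) (by positivity)
    push_cast
    rw [pow_succ]
    linarith
  · rw [Nat.floor_of_nonpos (by nlinarith [pow_pos (two_pos (α := ℝ)) n])]
    simp

lemma tendsto_dyadicValue_floor (hx : ∀ n k, x n k ∈ Set.Icc (0:ℝ) 1) (t : ℝ) :
    Tendsto (fun n : ℕ => dyadicValue x n ⌊2 ^ n * t⌋₊) atTop (𝓝 (dyadicMap x t)) :=
  tendsto_atTop_ciSup (monotone_dyadicValue_floor hx t) (bddAbove_range_dyadicValue hx _)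

lemma dyadicMap_mono (hx : ∀ n k, x n k ∈ Set.Icc (0:ℝ) 1) : Monotone (dyadicMap x) := by
  intro s t hst
  refine ciSup_mono (bddAbove_range_dyadicValue hx _) fun n => ?_
  exact dyadicValue_mono hx n (Nat.floor_le_floor (by gcongr))

lemma dyadicMap_nonneg (hx : ∀ n k, x n k ∈ Set.Icc (0:ℝ) 1) (t : ℝ) : 0 ≤ dyadicMap x t :=
  (dyadicValue_nonneg hx 0 _).trans (dyadicValue_floor_le hx 0 t)

lemma dyadicMap_le_one (hx : ∀ n k, x n k ∈ Set.Icc (0:ℝ) 1) (t : ℝ) : dyadicMap x t ≤ 1 :=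
  ciSup_le fun n => dyadicValue_le_one hx n _

/-- Self-similarity of the limit function. -/
lemma dyadicMap_subtree (hx : ∀ n k, x n k ∈ Set.Icc (0:ℝ) 1) (r k : ℕ) {s : ℝ}
    (hs : s ∈ Set.Icc (0:ℝ) 1) :
    dyadicMap x ((k + s) / 2 ^ r) = dyadicValue x r k +
      (dyadicValue x r (k + 1) - dyadicValue x r k) * dyadicMap (subtree x r k) s := by
  have h1 : Tendsto (fun n : ℕ => dyadicValue x (r + n) ⌊2 ^ (r + n) * ((k + s) / 2 ^ r)⌋₊) atTop
      (𝓝 (dyadicMap x ((k + s) / 2 ^ r))) := by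
    have := (tendsto_dyadicValue_floor hx ((k + s) / 2 ^ r)).comp (tendsto_add_atTop_nat r)
    simpa [Function.comp_def, add_comm r] using this
  have h2 := ((tendsto_dyadicValue_floor (x := subtree x r k) (fun n j => hx _ _) s).const_mul
    (dyadicValue x r (k + 1) - dyadicValue x r k)).const_add (dyadicValue x r k)
  refine tendsto_nhds_unique h1 (h2.congr fun n => ?_)
  have e : (2:ℝ) ^ (r + n) * ((k + s) / 2 ^ r) = 2 ^ n * s + ((k * 2 ^ n : ℕ) : ℝ) := by
    push_cast; rw [pow_add]; field_simp; ring
  have hfl : ⌊(2:ℝ) ^ n * s⌋₊ ≤ 2 ^ n := by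
    refine Nat.floor_le_of_le ?_
    push_cast
    exact mul_le_of_le_one_right (by positivity) hs.2
  rw [e, Nat.floor_add_natCast (by have := hs.1; positivity), add_comm ⌊_⌋₊,
    ← dyadicValue_subtree x r k n hfl]

lemma dyadicMap_dyadic (hx : ∀ n k, x n k ∈ Set.Icc (0:ℝ) 1) (n k : ℕ) :
    dyadicMap x ((k : ℝ) / 2 ^ n) = dyadicValue x n k := by
  have h := dyadicMap_subtree hx n k (s := 0) (by simp)
  have h0 : dyadicMap (subtree x n k) 0 = 0 := by
    simp [dyadicMap, dyadicValue_zero_right]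
  rw [h0] at h
  simpa using h

lemma dyadicMap_zero (x : ℕ → ℕ → ℝ) : dyadicMap x 0 = 0 := by
  simp [dyadicMap, dyadicValue_zero_right]

lemma dyadicMap_one (x : ℕ → ℕ → ℝ) : dyadicMap x 1 = 1 := by
  have : ∀ n : ℕ, dyadicValue x n ⌊(2:ℝ) ^ n * 1⌋₊ = 1 := by
    intro n
    refine dyadicValue_of_two_pow_le x ?_
    rw [mul_one]
    exact Nat.le_floor (by push_cast; exact le_rfl)
  simp only [dyadicMap, this, ciSup_const]

/-- On the left half of a dyadic interval of level `R`, the value of the limit function splits into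
the endpoints, the variable at the midpoint, and the values inside the left half. -/
lemma dyadicMap_left_half (hx : ∀ n k, x n k ∈ Set.Icc (0:ℝ) 1) (R k : ℕ) {s : ℝ}
    (hs : s ∈ Set.Icc (0:ℝ) 1) :
    dyadicMap x ((2 * k + s) / 2 ^ (R + 1)) = dyadicValue x R k +
      (dyadicValue x R (k + 1) - dyadicValue x R k) *
        (x (R + 1) (2 * k + 1) * dyadicMap (subtree x (R + 1) (2 * k)) s) := by
  have h := dyadicMap_subtree hx (R + 1) (2 * k) hs
  rw [dyadicValue_even, dyadicValue_odd] at h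
  push_cast at h
  rw [h]; ring

lemma dyadicMap_right_half (hx : ∀ n k, x n k ∈ Set.Icc (0:ℝ) 1) (R k : ℕ) {s : ℝ}
    (hs : s ∈ Set.Icc (0:ℝ) 1) :
    dyadicMap x ((2 * k + 1 + s) / 2 ^ (R + 1)) = dyadicValue x R (k + 1) -
      (dyadicValue x R (k + 1) - dyadicValue x R k) *
        ((1 - x (R + 1) (2 * k + 1)) * (1 - dyadicMap (subtree x (R + 1) (2 * k + 1)) s)) := by
  have h := dyadicMap_subtree hx (R + 1) (2 * k + 1) hs
  rw [dyadicValue_odd, show 2 * k + 1 + 1 = 2 * (k + 1) by ring, dyadicValue_even] at h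
  push_cast at h
  rw [h]; ring

lemma dyadicMap_le_dyadicValue (hx : ∀ n k, x n k ∈ Set.Icc (0:ℝ) 1) {n k : ℕ} {t : ℝ}
    (ht : t ≤ k / 2 ^ n) : dyadicMap x t ≤ dyadicValue x n k := by
  rw [← dyadicMap_dyadic hx]; exact dyadicMap_mono hx ht

lemma dyadicValue_le_dyadicMap (hx : ∀ n k, x n k ∈ Set.Icc (0:ℝ) 1) {n k : ℕ} {t : ℝ}
    (ht : k / 2 ^ n ≤ t) : dyadicValue x n k ≤ dyadicMap x t := by
  rw [← dyadicMap_dyadic hx]; exact dyadicMap_mono hx ht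

/-- The lengths of the images of the dyadic intervals tend to `0`, uniformly on each level. -/
def GapsVanish (x : ℕ → ℕ → ℝ) : Prop :=
  ∀ ε : ℝ, 0 < ε → ∃ n : ℕ, ∀ k < 2 ^ n, dyadicValue x n (k + 1) - dyadicValue x n k < ε

lemma dyadicValue_succ_sub_lt_of_forall_lt {n : ℕ} {ε : ℝ} (hε : 0 < ε)
    (h : ∀ k < 2 ^ n, dyadicValue x n (k + 1) - dyadicValue x n k < ε) (k : ℕ) :
    dyadicValue x n (k + 1) - dyadicValue x n k < ε := by
  rcases lt_or_ge k (2 ^ n) with hk | hk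
  · exact h k hk
  · rwa [dyadicValue_of_two_pow_le x hk, dyadicValue_of_two_pow_le x (hk.trans (Nat.le_succ k)),
      sub_self]

lemma dyadicMap_continuousOn (hx : ∀ n k, x n k ∈ Set.Icc (0:ℝ) 1) (hgap : GapsVanish x) :
    ContinuousOn (dyadicMap x) (Set.Icc 0 1) := by
  rw [Metric.continuousOn_iff]
  intro t ht ε hε
  obtain ⟨n, hn⟩ := hgap (ε / 2) (by positivity)
  have hn' := dyadicValue_succ_sub_lt_of_forall_lt (by positivity) hn
  have key : ∀ s t : ℝ, 0 ≤ s → s ≤ t → t - s < 1 / 2 ^ n → dyadicMap x t - dyadicMap x s < ε := by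
    intro s t hs hst hd
    have h2 : (0:ℝ) < 2 ^ n := by positivity
    have h1 := Nat.floor_le (a := 2 ^ n * s) (by positivity)
    have h3 := Nat.lt_floor_add_one (2 ^ n * s)
    set k := ⌊2 ^ n * s⌋₊
    have h4 : dyadicValue x n k ≤ dyadicMap x s := dyadicValue_floor_le hx n s
    have h5 : dyadicMap x t ≤ dyadicValue x n (k + 1 + 1) := by
      refine dyadicMap_le_dyadicValue hx ?_
      rw [lt_div_iff₀ h2] at hd
      rw [le_div_iff₀ h2]
      push_cast
      nlinarith
    have := hn' k
    have := hn' (k + 1)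
    linarith
  refine ⟨1 / 2 ^ n, by positivity, fun s hs hd => ?_⟩
  rw [Real.dist_eq] at hd ⊢
  rcases le_total s t with h | h
  · rw [abs_sub_comm, abs_of_nonneg (by linarith)] at hd
    rw [abs_sub_comm, abs_of_nonneg (sub_nonneg.2 (dyadicMap_mono hx h))]
    exact key s t hs.1 h hd
  · rw [abs_of_nonneg (by linarith)] at hd
    rw [abs_of_nonneg (sub_nonneg.2 (dyadicMap_mono hx h))]
    exact key t s ht.1 h hd

lemma dyadicValue_lt_succ (hx : ∀ n k, x n k ∈ Set.Ioo (0:ℝ) 1) {n k : ℕ} (hk : k < 2 ^ n) :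
    dyadicValue x n k < dyadicValue x n (k + 1) := by
  induction n generalizing k with
  | zero => simp at hk; simp [dyadicValue, hk]
  | succ n ih =>
    rw [pow_succ] at hk
    obtain ⟨j, rfl | rfl⟩ := Nat.even_or_odd' k
    · rw [dyadicValue_even, dyadicValue_odd]
      have := ih (k := j) (by omega)
      nlinarith [(hx (n + 1) (2 * j + 1)).1]
    · rw [dyadicValue_odd, show 2 * j + 1 + 1 = 2 * (j + 1) by ring, dyadicValue_even]
      have := ih (k := j) (by omega)
      nlinarith [(hx (n + 1) (2 * j + 1)).2]

lemma dyadicMap_strictMonoOn (hx : ∀ n k, x n k ∈ Set.Ioo (0:ℝ) 1) :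
    StrictMonoOn (dyadicMap x) (Set.Icc 0 1) := by
  have hx' : ∀ n k, x n k ∈ Set.Icc (0:ℝ) 1 := fun n k => Set.Ioo_subset_Icc_self (hx n k)
  intro s hs t ht hst
  obtain ⟨n, hn⟩ := pow_unbounded_of_one_lt (2 / (t - s)) (one_lt_two)
  have h2 : (0:ℝ) < 2 ^ n := by positivity
  rw [div_lt_iff₀ (by linarith)] at hn
  have h1 := Nat.le_ceil (2 ^ n * s)
  have h3 := Nat.ceil_lt_add_one (a := 2 ^ n * s) (by have := hs.1; positivity)
  set k := ⌈2 ^ n * s⌉₊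
  have hkt : ((k + 1 : ℕ) : ℝ) ≤ 2 ^ n * t := by push_cast; nlinarith
  have hk : k + 1 ≤ 2 ^ n := by
    have : ((k + 1 : ℕ) : ℝ) ≤ ((2 ^ n : ℕ) : ℝ) := by
      push_cast at hkt ⊢; nlinarith [ht.2]
    exact_mod_cast this
  calc dyadicMap x s ≤ dyadicValue x n k :=
        dyadicMap_le_dyadicValue hx' (by rw [le_div_iff₀ h2]; linarith)
    _ < dyadicValue x n (k + 1) := dyadicValue_lt_succ hx (by omega)
    _ ≤ dyadicMap x t := dyadicValue_le_dyadicMap hx' (by rw [div_le_iff₀ h2]; linarith)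

/-- An array with entries in `(0, 1)` and vanishing gaps yields a homeomorphism of `[0, 1]`. -/
lemma exists_homeomorph_of_gapsVanish (hx : ∀ n k, x n k ∈ Set.Ioo (0:ℝ) 1) (hgap : GapsVanish x) :
    ∃ φ : unitInterval ≃ₜ unitInterval, ∀ t : unitInterval, (φ t : ℝ) = dyadicMap x t := by
  have hx' : ∀ n k, x n k ∈ Set.Icc (0:ℝ) 1 := fun n k => Set.Ioo_subset_Icc_self (hx n k)
  let g : unitInterval → unitInterval := fun t =>
    ⟨dyadicMap x t, dyadicMap_nonneg hx' t, dyadicMap_le_one hx' t⟩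
  have hg : StrictMono g := fun s t hst => dyadicMap_strictMonoOn hx s.2 t.2 hst
  have hs : Function.Surjective g := by
    intro y
    have h := intermediate_value_Icc zero_le_one (dyadicMap_continuousOn hx' hgap)
    rw [dyadicMap_zero, dyadicMap_one] at h
    obtain ⟨t, ht, hty⟩ := h y.2
    exact ⟨⟨t, ht⟩, Subtype.ext hty⟩
  exact ⟨(hg.orderIsoOfSurjective g hs).toHomeomorph, fun t => rfl⟩

/-! ### Reflection -/

/-- The array of the homeomorphism `t ↦ 1 - φ (1 - t)`. -/
def reflect (x : ℕ → ℕ → ℝ) : ℕ → ℕ → ℝ := fun n k => 1 - x n (2 ^ n - k)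

lemma dyadicValue_reflect (x : ℕ → ℕ → ℝ) {n k : ℕ} (hk : k ≤ 2 ^ n) :
    dyadicValue (reflect x) n k = 1 - dyadicValue x n (2 ^ n - k) := by
  induction n generalizing k with
  | zero =>
    rcases Nat.le_one_iff_eq_zero_or_eq_one.1 (by simpa using hk) with rfl | rfl <;>
      simp [dyadicValue]
  | succ n ih =>
    rw [pow_succ] at hk
    obtain ⟨j, rfl | rfl⟩ := Nat.even_or_odd' k
    · rw [dyadicValue_even, ih (by omega), ← dyadicValue_even x n]
      congr 2; rw [pow_succ]; omega
    · have e : 2 ^ (n + 1) - (2 * j + 1) = 2 * (2 ^ n - (j + 1)) + 1 := by rw [pow_succ]; omega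
      have e2 : 2 ^ n - (j + 1) + 1 = 2 ^ n - j := by omega
      rw [e, dyadicValue_odd, dyadicValue_odd, ih (by omega), ih (by omega), e2]
      simp only [reflect, e]
      ring

lemma dyadicMap_reflect (hx : ∀ n k, x n k ∈ Set.Icc (0:ℝ) 1) (hgap : GapsVanish x) {t : ℝ}
    (ht : t ∈ Set.Icc (0:ℝ) 1) : dyadicMap (reflect x) t = 1 - dyadicMap x (1 - t) := by
  have hx' : ∀ n k, reflect x n k ∈ Set.Icc (0:ℝ) 1 := fun n k => by
    have := hx n (2 ^ n - k)
    exact ⟨by simp only [reflect]; linarith [this.2], by simp only [reflect]; linarith [this.1]⟩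
  rcases eq_or_lt_of_le ht.2 with rfl | ht1
  · simp [dyadicMap_one, dyadicMap_zero]
  refine eq_of_abs_sub_le_all fun ε hε => ?_
  obtain ⟨n, hn⟩ := hgap ε hε
  have h2 : (0:ℝ) < 2 ^ n := by positivity
  have h1 := Nat.floor_le (a := 2 ^ n * t) (by have := ht.1; positivity)
  have h3 := Nat.lt_floor_add_one (2 ^ n * t)
  set k := ⌊2 ^ n * t⌋₊ with hk
  have hk1 : k + 1 ≤ 2 ^ n := by
    have : (k : ℝ) < ((2 ^ n : ℕ) : ℝ) := by push_cast; nlinarith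
    exact_mod_cast this
  have a1 : dyadicValue (reflect x) n k ≤ dyadicMap (reflect x) t :=
    dyadicValue_le_dyadicMap hx' (by rw [div_le_iff₀ h2]; linarith)
  have a2 : dyadicMap (reflect x) t ≤ dyadicValue (reflect x) n (k + 1) :=
    dyadicMap_le_dyadicValue hx' (by rw [le_div_iff₀ h2]; push_cast; linarith)
  have a3 : dyadicMap x (1 - t) ≤ dyadicValue x n (2 ^ n - k) :=
    dyadicMap_le_dyadicValue hx (by
      rw [le_div_iff₀ h2, Nat.cast_sub (by omega)]; push_cast; linarith)
  have a4 : dyadicValue x n (2 ^ n - (k + 1)) ≤ dyadicMap x (1 - t) :=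
    dyadicValue_le_dyadicMap hx (by
      rw [div_le_iff₀ h2, Nat.cast_sub hk1]; push_cast; linarith)
  rw [dyadicValue_reflect x (by omega)] at a1
  rw [dyadicValue_reflect x hk1] at a2
  have a5 := hn (2 ^ n - (k + 1)) (by omega)
  rw [show 2 ^ n - (k + 1) + 1 = 2 ^ n - k by omega] at a5
  rw [abs_le]
  constructor <;> linarith

lemma dyadicMap_congr {y : ℕ → ℕ → ℝ} (h : ∀ n k, Odd k → k < 2 ^ n → x n k = y n k) {t : ℝ}
    (ht : t ≤ 1) : dyadicMap x t = dyadicMap y t := by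
  unfold dyadicMap
  congr 1; ext n
  refine dyadicValue_congr h (Nat.floor_le_of_le ?_)
  push_cast
  exact mul_le_of_le_one_right (by positivity) ht

end Dyadic

/-! ### Averaging over the variable at the midpoint of a dyadic interval -/

/-- `abs_integral_average_dilation_le` when the lower bound for `ψ` holds only on a subinterval;
the rest is bounded trivially. -/
lemma abs_integral_average_dilation_le' {w ψ H : ℝ → ℝ} {a b c d K W δ : ℝ} (hac : a ≤ c)
    (hcd : c ≤ d) (hdb : d ≤ b) (hδ : 0 < δ)
    (hK : ∀ s t, a ≤ s → s ≤ t → t ≤ b → |∫ u in s..t, w u| ≤ K)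
    (hw : Continuous w) (hW : ∀ t ∈ Set.Icc a b, |w t| ≤ W) (hψm : Measurable ψ)
    (hψ : MonotoneOn ψ (Set.Icc a b) ∨ AntitoneOn ψ (Set.Icc a b))
    (hψδ : ∀ t ∈ Set.Icc c d, δ ≤ ψ t) (hψ1 : ∀ t, ψ t ≤ 1)
    (hH : Measurable H) (hH1 : ∀ y, |H y| ≤ 1) :
    |∫ v in Set.Icc (0:ℝ) 1, ∫ t in Set.Icc a b, H (v * ψ t) * w t|
      ≤ W * ((b - a) - (d - c)) + K * (1 + Real.log (1 / δ)) := by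
  have hsub : Set.Icc c d ⊆ Set.Icc a b := Set.Icc_subset_Icc hac hdb
  have hW0 : 0 ≤ W := (abs_nonneg _).trans (hW a ⟨le_rfl, hac.trans (hcd.trans hdb)⟩)
  have hmeas : Measurable fun p : ℝ × ℝ => H (p.1 * ψ p.2) * w p.2 :=
    (hH.comp (measurable_fst.mul (hψm.comp measurable_snd))).mul (hw.measurable.comp measurable_snd)
  have hbd : ∀ v, ∀ t ∈ Set.Icc a b, ‖H (v * ψ t) * w t‖ ≤ W := by
    intro v t ht
    rw [norm_mul]
    exact (mul_le_of_le_one_left (norm_nonneg _) (hH1 _)).trans (hW t ht)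
  have hint : ∀ v, IntegrableOn (fun t => H (v * ψ t) * w t) (Set.Icc a b) := fun v =>
    Measure.integrableOn_of_bounded (by simp)
      (hmeas.comp (measurable_const.prodMk measurable_id)).aestronglyMeasurable
      ((ae_restrict_mem measurableSet_Icc).mono fun t ht => hbd v t ht)
  have hintv : ∀ E ⊆ Set.Icc a b, MeasurableSet E →
      IntegrableOn (fun v => ∫ t in E, H (v * ψ t) * w t) (Set.Icc 0 1) := by
    intro E hE hEm
    refine Measure.integrableOn_of_bounded (M := W * volume.real (Set.Icc a b)) (by simp)
      (hmeas.stronglyMeasurable.integral_prod_right').aestronglyMeasurable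
      (ae_of_all _ fun v => ?_)
    calc _ ≤ W * volume.real E := norm_setIntegral_le_of_norm_le_const
            ((measure_mono hE).trans_lt (by simp)) fun t ht => hbd v t (hE ht)
      _ ≤ _ := by
        gcongr
        exact (by simp : volume (Set.Icc a b) < ⊤).ne
  have hsplit : ∀ v, ∫ t in Set.Icc a b, H (v * ψ t) * w t
      = (∫ t in Set.Icc a b \ Set.Icc c d, H (v * ψ t) * w t)
        + ∫ t in Set.Icc c d, H (v * ψ t) * w t := by
    intro v
    have := setIntegral_sdiff measurableSet_Icc (hint v) hsub
    rw [this]; ring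
  simp_rw [hsplit]
  rw [integral_add (hintv _ Set.sdiff_subset (measurableSet_Icc.diff measurableSet_Icc))
    (hintv _ hsub measurableSet_Icc)]
  refine (abs_add_le _ _).trans (add_le_add ?_ ?_)
  · rw [← Real.norm_eq_abs]
    have hvol : volume.real (Set.Icc a b \ Set.Icc c d) = (b - a) - (d - c) := by
      rw [measureReal_sdiff hsub measurableSet_Icc (h₁ := measure_Icc_lt_top.ne)]
      simp [hcd, hac.trans (hcd.trans hdb)]
    calc _ ≤ (W * ((b - a) - (d - c))) * volume.real (Set.Icc (0:ℝ) 1) := by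
          refine norm_setIntegral_le_of_norm_le_const (by simp) fun v _ => ?_
          rw [← hvol]
          exact norm_setIntegral_le_of_norm_le_const
            ((measure_mono Set.sdiff_subset).trans_lt (by simp : volume (Set.Icc a b) < ⊤))
            fun t ht => hbd v t ht.1
      _ = _ := by simp
  · refine abs_integral_average_dilation_le hcd hδ
      (fun s t h1 h2 h3 => hK s t (hac.trans h1) h2 (h3.trans hdb))
      hw.integrableOn_Icc hψm (hψ.imp (fun h => h.mono hsub) fun h => h.mono hsub) hψδ
      (fun t _ => hψ1 t) hH hH1

/-- The integral of `h ∘ φ` against `w` over the dyadic interval `[k / 2 ^ R, (k + 1) / 2 ^ R]`, as a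
function of the value `v` of the variable attached to its midpoint. -/
noncomputable def cellIntegral (h w : ℝ → ℝ) (x : ℕ → ℕ → ℝ) (R k : ℕ) (v : ℝ) : ℝ :=
  (∫ t in Set.Icc ((2 * k : ℝ) / 2 ^ (R + 1)) ((2 * k + 1) / 2 ^ (R + 1)),
    h (dyadicValue x R k + (dyadicValue x R (k + 1) - dyadicValue x R k) *
      (v * dyadicMap (subtree x (R + 1) (2 * k)) (2 ^ (R + 1) * t - 2 * k))) * w t) +
  ∫ t in Set.Icc ((2 * k + 1 : ℝ) / 2 ^ (R + 1)) ((2 * k + 2) / 2 ^ (R + 1)),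
    h (dyadicValue x R (k + 1) - (dyadicValue x R (k + 1) - dyadicValue x R k) *
      ((1 - v) * (1 - dyadicMap (subtree x (R + 1) (2 * k + 1)) (2 ^ (R + 1) * t - 2 * k - 1)))) * w t

section Cell

variable {h w : ℝ → ℝ} {x y : ℕ → ℕ → ℝ} {R k : ℕ}

lemma dyadicValue_congr_of_level_le {n : ℕ} (hxy : ∀ m ≤ n, ∀ k, x m k = y m k) (k : ℕ) :
    dyadicValue x n k = dyadicValue y n k := by
  induction n generalizing k with
  | zero => simp [dyadicValue]
  | succ n ih =>
    have ih := ih fun m hm => hxy m (hm.trans (Nat.le_succ n))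
    obtain ⟨j, rfl | rfl⟩ := Nat.even_or_odd' k
    · rw [dyadicValue_even, dyadicValue_even, ih]
    · rw [dyadicValue_odd, dyadicValue_odd, ih, ih, hxy _ le_rfl]

lemma measurable_dyadicMap (hx : ∀ n k, x n k ∈ Set.Icc (0:ℝ) 1) : Measurable (dyadicMap x) :=
  (dyadicMap_mono hx).measurable

/-- `cellIntegral` does not involve the variables of level `R + 1`. -/
lemma cellIntegral_congr (hxy : ∀ n k, n ≠ R + 1 → x n k = y n k) (v : ℝ) :
    cellIntegral h w x R k v = cellIntegral h w y R k v := by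
  have hD : ∀ j, dyadicValue x R j = dyadicValue y R j := fun j =>
    dyadicValue_congr_of_level_le (fun m hm k => hxy m k (by omega)) j
  have hS : ∀ j, ∀ t ≤ 1,
      dyadicMap (subtree x (R + 1) j) t = dyadicMap (subtree y (R + 1) j) t := by
    intro j t ht
    refine dyadicMap_congr (fun n i hi hin => ?_) ht
    have hn : n ≠ 0 := by
      rintro rfl
      have : i = 0 := by simpa using hin
      simp [this] at hi
    exact hxy _ _ (by omega)
  have h2 : (0:ℝ) < 2 ^ (R + 1) := by positivity
  unfold cellIntegral
  congr 1
  · refine setIntegral_congr_fun measurableSet_Icc fun t ht => ?_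
    have h3 := ht.2
    rw [le_div_iff₀ h2] at h3
    simp only [hD, hS (2 * k) (2 ^ (R + 1) * t - 2 * k) (by linarith)]
  · refine setIntegral_congr_fun measurableSet_Icc fun t ht => ?_
    have h3 := ht.2
    rw [le_div_iff₀ h2] at h3
    simp only [hD, hS (2 * k + 1) (2 ^ (R + 1) * t - 2 * k - 1) (by linarith)]

lemma intervalIntegrable_dyadicMap_comp (hh : Measurable h) (hh1 : ∀ y, |h y| ≤ 1)
    (hw : Continuous w) (hx : ∀ n k, x n k ∈ Set.Icc (0:ℝ) 1) (a b : ℝ) :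
    IntervalIntegrable (fun t => h (dyadicMap x t) * w t) volume a b := by
  rw [intervalIntegrable_iff]
  refine (hw.integrableOn_uIoc).bdd_mul (c := 1)
    ((hh.comp (measurable_dyadicMap hx)).aestronglyMeasurable) (ae_of_all _ fun t => hh1 _)

/-- At the actual value of the midpoint variable, `cellIntegral` is the integral over the cell. -/
lemma cellIntegral_self (hh : Measurable h) (hh1 : ∀ y, |h y| ≤ 1) (hw : Continuous w)
    (hx : ∀ n k, x n k ∈ Set.Icc (0:ℝ) 1) :
    cellIntegral h w x R k (x (R + 1) (2 * k + 1))
      = ∫ t in (k : ℝ) / 2 ^ R..(k + 1 : ℕ) / 2 ^ R, h (dyadicMap x t) * w t := by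
  have h2 : (0:ℝ) < 2 ^ (R + 1) := by positivity
  have e1 : (k : ℝ) / 2 ^ R = 2 * k / 2 ^ (R + 1) := by rw [pow_succ]; field_simp
  have e2 : ((k + 1 : ℕ) : ℝ) / 2 ^ R = (2 * k + 2) / 2 ^ (R + 1) := by
    rw [pow_succ]; push_cast; field_simp
  have hi := intervalIntegrable_dyadicMap_comp hh hh1 hw hx
  rw [e1, e2, ← intervalIntegral.integral_add_adjacent_intervals
    (hi _ ((2 * k + 1) / 2 ^ (R + 1))) (hi _ _),
    intervalIntegral.integral_of_le (by gcongr; linarith),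
    intervalIntegral.integral_of_le (by gcongr; linarith),
    ← integral_Icc_eq_integral_Ioc, ← integral_Icc_eq_integral_Ioc]
  unfold cellIntegral
  congr 1
  · refine setIntegral_congr_fun measurableSet_Icc fun t ht => ?_
    have h3 := ht.2
    have h4 := ht.1
    rw [le_div_iff₀ h2] at h3
    rw [div_le_iff₀ h2] at h4
    have := dyadicMap_left_half hx R k (s := 2 ^ (R + 1) * t - 2 * k)
      ⟨by linarith, by linarith⟩
    rw [← this]
    congr 3
    field_simp; ring
  · refine setIntegral_congr_fun measurableSet_Icc fun t ht => ?_
    have h3 := ht.2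
    have h4 := ht.1
    rw [le_div_iff₀ h2] at h3
    rw [div_le_iff₀ h2] at h4
    have := dyadicMap_right_half hx R k (s := 2 ^ (R + 1) * t - 2 * k - 1)
      ⟨by linarith, by linarith⟩
    rw [← this]
    congr 3
    field_simp; ring

lemma abs_cellIntegral_le (hh1 : ∀ y, |h y| ≤ 1) {W : ℝ}
    (hW : ∀ t ∈ Set.Icc ((k : ℝ) / 2 ^ R) ((k + 1) / 2 ^ R), |w t| ≤ W) (v : ℝ) :
    |cellIntegral h w x R k v| ≤ W * (1 / 2 ^ R) := by
  have h2 : (0:ℝ) < 2 ^ (R + 1) := by positivity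
  have e1 : (k : ℝ) / 2 ^ R = 2 * k / 2 ^ (R + 1) := by rw [pow_succ]; field_simp
  have e2 : ((k : ℝ) + 1) / 2 ^ R = (2 * k + 2) / 2 ^ (R + 1) := by
    rw [pow_succ]; field_simp
  rw [e1, e2] at hW
  have hb : ∀ (z : ℝ), ∀ t ∈ Set.Icc (2 * (k:ℝ) / 2 ^ (R + 1)) ((2 * k + 2) / 2 ^ (R + 1)),
      ‖h z * w t‖ ≤ W := by
    intro z t ht
    rw [norm_mul]
    exact (mul_le_of_le_one_left (norm_nonneg _) (hh1 _)).trans (hW t ht)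
  have l1 : (2 * (k:ℝ)) / 2 ^ (R + 1) ≤ (2 * k + 1) / 2 ^ (R + 1) := by gcongr; linarith
  have l2 : (2 * (k:ℝ) + 1) / 2 ^ (R + 1) ≤ (2 * k + 2) / 2 ^ (R + 1) := by gcongr; linarith
  unfold cellIntegral
  refine (abs_add_le _ _).trans ?_
  have b1 := norm_setIntegral_le_of_norm_le_const (μ := volume)
    (s := Set.Icc ((2 * k : ℝ) / 2 ^ (R + 1)) ((2 * k + 1) / 2 ^ (R + 1))) (C := W) (by simp)
    (fun t ht => hb (dyadicValue x R k + (dyadicValue x R (k + 1) - dyadicValue x R k) *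
      (v * dyadicMap (subtree x (R + 1) (2 * k)) (2 ^ (R + 1) * t - 2 * k))) t
      ⟨ht.1, ht.2.trans l2⟩)
  have b2 := norm_setIntegral_le_of_norm_le_const (μ := volume)
    (s := Set.Icc ((2 * k + 1 : ℝ) / 2 ^ (R + 1)) ((2 * k + 2) / 2 ^ (R + 1))) (C := W) (by simp)
    (fun t ht => hb (dyadicValue x R (k + 1) - (dyadicValue x R (k + 1) - dyadicValue x R k) *
      ((1 - v) * (1 - dyadicMap (subtree x (R + 1) (2 * k + 1)) (2 ^ (R + 1) * t - 2 * k - 1)))) t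
      ⟨l1.trans ht.1, ht.2⟩)
  rw [Real.volume_real_Icc_of_le l1] at b1
  rw [Real.volume_real_Icc_of_le l2] at b2
  refine (add_le_add b1 b2).trans (le_of_eq ?_)
  rw [pow_succ]; field_simp; ring

lemma measurable_cellIntegral (hh : Measurable h) (hw : Continuous w)
    (hx : ∀ n k, x n k ∈ Set.Icc (0:ℝ) 1) (R k : ℕ) : Measurable (cellIntegral h w x R k) := by
  have hm : ∀ j, Measurable (dyadicMap (subtree x (R + 1) j)) := fun j =>
    measurable_dyadicMap fun n i => hx _ _
  unfold cellIntegral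
  refine Measurable.add ?_ ?_
  · refine StronglyMeasurable.measurable (StronglyMeasurable.integral_prod_right ?_)
    refine Measurable.stronglyMeasurable ?_
    refine (hh.comp ?_).mul (hw.measurable.comp measurable_snd)
    refine measurable_const.add (measurable_const.mul (measurable_fst.mul ((hm _).comp ?_)))
    fun_prop
  · refine StronglyMeasurable.measurable (StronglyMeasurable.integral_prod_right ?_)
    refine Measurable.stronglyMeasurable ?_
    refine (hh.comp ?_).mul (hw.measurable.comp measurable_snd)
    refine measurable_const.sub (measurable_const.mul
      ((measurable_const.sub measurable_fst).mul (measurable_const.sub ((hm _).comp ?_))))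
    fun_prop

/-- The average of `cellIntegral` over a uniform midpoint variable is small, provided that the
images of the outermost dyadic intervals `q` levels below are not exponentially small. -/
lemma abs_integral_cellIntegral_le (hh : Measurable h) (hh1 : ∀ y, |h y| ≤ 1) (hw : Continuous w)
    (hx : ∀ n k, x n k ∈ Set.Icc (0:ℝ) 1) {W K δ : ℝ} (q : ℕ) (hδ : 0 < δ)
    (hW : ∀ t ∈ Set.Icc ((k : ℝ) / 2 ^ R) ((k + 1) / 2 ^ R), |w t| ≤ W)
    (hK : ∀ s t, (k : ℝ) / 2 ^ R ≤ s → s ≤ t → t ≤ (k + 1) / 2 ^ R → |∫ u in s..t, w u| ≤ K)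
    (hl : δ ≤ dyadicValue (subtree x (R + 1) (2 * k)) q 1)
    (hr : δ ≤ 1 - dyadicValue (subtree x (R + 1) (2 * k + 1)) q (2 ^ q - 1)) :
    |∫ v in Set.Icc (0:ℝ) 1, cellIntegral h w x R k v|
      ≤ 2 * (W * (1 / 2 ^ (R + 1 + q)) + K * (1 + Real.log (1 / δ))) := by
  have h2 : (0:ℝ) < 2 ^ (R + 1) := by positivity
  have hq : (0:ℝ) < 2 ^ q := by positivity
  have hq1 : 1 / (2:ℝ) ^ q ≤ 1 := by
    rw [div_le_one hq]; exact one_le_pow₀ one_le_two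
  have e1 : (k : ℝ) / 2 ^ R = 2 * k / 2 ^ (R + 1) := by rw [pow_succ]; field_simp
  have e2 : ((k : ℝ) + 1) / 2 ^ R = (2 * k + 2) / 2 ^ (R + 1) := by
    rw [pow_succ]; field_simp
  rw [e1, e2] at hW hK
  have l1 : (2 * (k:ℝ)) / 2 ^ (R + 1) ≤ (2 * k + 1) / 2 ^ (R + 1) := by gcongr; linarith
  have l2 : (2 * (k:ℝ) + 1) / 2 ^ (R + 1) ≤ (2 * k + 2) / 2 ^ (R + 1) := by gcongr; linarith
  have hxs : ∀ j n i, subtree x (R + 1) j n i ∈ Set.Icc (0:ℝ) 1 := fun j n i => hx _ _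
  have hm : ∀ j, Measurable (dyadicMap (subtree x (R + 1) j)) := fun j =>
    measurable_dyadicMap (hxs j)
  set a := dyadicValue x R k
  set b := dyadicValue x R (k + 1)
  set HL : ℝ → ℝ := fun z => h (a + (b - a) * z) with hHL
  set HR : ℝ → ℝ := fun z => h (b - (b - a) * z) with hHR
  set ψL : ℝ → ℝ := fun t => dyadicMap (subtree x (R + 1) (2 * k)) (2 ^ (R + 1) * t - 2 * k) with hψL
  set ψR : ℝ → ℝ := fun t =>
    1 - dyadicMap (subtree x (R + 1) (2 * k + 1)) (2 ^ (R + 1) * t - 2 * k - 1) with hψR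
  have hHLm : Measurable HL := hh.comp (by fun_prop)
  have hHRm : Measurable HR := hh.comp (by fun_prop)
  have hψLm : Measurable ψL := (hm _).comp (by fun_prop)
  have hψRm : Measurable ψR := measurable_const.sub ((hm _).comp (by fun_prop))
  have left := abs_integral_average_dilation_le' (w := w) (ψ := ψL) (H := HL)
    (a := 2 * k / 2 ^ (R + 1)) (b := (2 * k + 1) / 2 ^ (R + 1))
    (c := (2 * k + 1 / 2 ^ q) / 2 ^ (R + 1)) (d := (2 * k + 1) / 2 ^ (R + 1)) (K := K) (W := W)
    (δ := δ) (by gcongr; simp) (by gcongr) le_rfl hδ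
    (fun s t h1 h3 h4 => hK s t h1 h3 (h4.trans l2)) hw (fun t ht => hW t ⟨ht.1, ht.2.trans l2⟩)
    hψLm (Or.inl fun s _ t _ hst => dyadicMap_mono (hxs _) (by gcongr))
    (fun t ht => by
      refine hl.trans (dyadicValue_le_dyadicMap (hxs _) ?_)
      have h3 := ht.1
      rw [div_le_iff₀ h2] at h3
      push_cast; linarith)
    (fun t => dyadicMap_le_one (hxs _) _) hHLm (fun z => hh1 _)
  have right := abs_integral_average_dilation_le' (w := w) (ψ := ψR) (H := HR)
    (a := (2 * k + 1) / 2 ^ (R + 1)) (b := (2 * k + 2) / 2 ^ (R + 1))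
    (c := (2 * k + 1) / 2 ^ (R + 1)) (d := (2 * k + 2 - 1 / 2 ^ q) / 2 ^ (R + 1)) (K := K) (W := W)
    (δ := δ) le_rfl (by gcongr; linarith) (by gcongr; simp) hδ
    (fun s t h1 h3 h4 => hK s t (l1.trans h1) h3 h4) hw (fun t ht => hW t ⟨l1.trans ht.1, ht.2⟩)
    hψRm (Or.inr fun s _ t _ hst => sub_le_sub_left (dyadicMap_mono (hxs _) (by gcongr)) _)
    (fun t ht => by
      refine hr.trans (sub_le_sub_left (dyadicMap_le_dyadicValue (hxs _) ?_) _)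
      have h3 := ht.2
      rw [le_div_iff₀ h2] at h3
      rw [Nat.cast_sub Nat.one_le_two_pow]
      push_cast
      rw [sub_div, div_self hq.ne']
      linarith)
    (fun t => sub_le_self _ (dyadicMap_nonneg (hxs _) _)) hHRm (fun z => hh1 _)
  have hmeas : ∀ (H ψ : ℝ → ℝ), Measurable H → (∀ z, |H z| ≤ 1) → Measurable ψ →
      ∀ c d : ℝ, 2 * (k:ℝ) / 2 ^ (R + 1) ≤ c → d ≤ (2 * k + 2) / 2 ^ (R + 1) →
      IntegrableOn (fun v => ∫ t in Set.Icc c d, H (v * ψ t) * w t) (Set.Icc 0 1) := by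
    intro H ψ hH hH1 hψ c d hc hd
    have hms : Measurable fun p : ℝ × ℝ => H (p.1 * ψ p.2) * w p.2 :=
      (hH.comp (measurable_fst.mul (hψ.comp measurable_snd))).mul (hw.measurable.comp measurable_snd)
    refine Measure.integrableOn_of_bounded (M := W * volume.real (Set.Icc c d)) (by simp)
      (hms.stronglyMeasurable.integral_prod_right').aestronglyMeasurable (ae_of_all _ fun v => ?_)
    refine norm_setIntegral_le_of_norm_le_const (by simp) fun t ht => ?_
    rw [norm_mul]
    exact (mul_le_of_le_one_left (norm_nonneg _) (hH1 _)).trans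
      (hW t ⟨hc.trans ht.1, ht.2.trans hd⟩)
  -- the right half involves `1 - v`, which is uniform as well
  have hflip : ∀ F : ℝ → ℝ, ∫ v in Set.Icc (0:ℝ) 1, F (1 - v) = ∫ v in Set.Icc (0:ℝ) 1, F v := by
    intro F
    rw [integral_Icc_eq_integral_Ioc, integral_Icc_eq_integral_Ioc,
      ← intervalIntegral.integral_of_le zero_le_one, ← intervalIntegral.integral_of_le zero_le_one,
      intervalIntegral.integral_comp_sub_left]
    simp
  have iL := hmeas HL ψL hHLm (fun z => hh1 _) hψLm _ _ le_rfl l2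
  have iR := hmeas HR ψR hHRm (fun z => hh1 _) hψRm _ _ l1 le_rfl
  have iR' : IntegrableOn (fun v => ∫ t in Set.Icc ((2 * k + 1 : ℝ) / 2 ^ (R + 1))
      ((2 * k + 2) / 2 ^ (R + 1)), HR ((1 - v) * ψR t) * w t) (Set.Icc 0 1) := by
    have h3 := (intervalIntegrable_iff_integrableOn_Icc_of_le zero_le_one).2 iR
    have h4 := (h3.comp_sub_left 1).symm
    simp only [sub_zero, sub_self] at h4
    exact (intervalIntegrable_iff_integrableOn_Icc_of_le zero_le_one).1 h4
  have hsum : ∫ v in Set.Icc (0:ℝ) 1, cellIntegral h w x R k v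
      = (∫ v in Set.Icc (0:ℝ) 1, ∫ t in Set.Icc ((2 * k : ℝ) / 2 ^ (R + 1))
          ((2 * k + 1) / 2 ^ (R + 1)), HL (v * ψL t) * w t)
        + ∫ v in Set.Icc (0:ℝ) 1, ∫ t in Set.Icc ((2 * k + 1 : ℝ) / 2 ^ (R + 1))
          ((2 * k + 2) / 2 ^ (R + 1)), HR (v * ψR t) * w t := by
    rw [← hflip (fun v => ∫ t in Set.Icc ((2 * k + 1 : ℝ) / 2 ^ (R + 1))
          ((2 * k + 2) / 2 ^ (R + 1)), HR (v * ψR t) * w t), ← integral_add iL iR']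
    rfl
  rw [hsum]
  refine (abs_add_le _ _).trans ((add_le_add left right).trans (le_of_eq ?_))
  rw [pow_add 2 (R + 1) q]
  field_simp
  ring

end Cell

/-! ### The canonical probability space -/

lemma measurable_piecewise_prod {ι : Type*} {E : ι → Type*} [∀ i, MeasurableSpace (E i)]
    (S : Set ι) [∀ i, Decidable (i ∈ S)] :
    Measurable (fun p : (∀ i, E i) × (∀ i, E i) => S.piecewise p.2 p.1) := by
  refine measurable_pi_iff.2 fun i => ?_
  by_cases hi : i ∈ S
  · simp only [Set.piecewise, hi, if_true]; fun_prop
  · simp only [Set.piecewise, hi, if_false]; fun_prop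

/-- Resampling: replacing the coordinates in `S` by those of an independent copy does not change a
product measure. -/
lemma infinitePi_map_piecewise {ι : Type*} {E : ι → Type*} [∀ i, MeasurableSpace (E i)]
    (μ : ∀ i, Measure (E i)) [∀ i, IsProbabilityMeasure (μ i)] (S : Set ι)
    [∀ i, Decidable (i ∈ S)] :
    ((Measure.infinitePi μ).prod (Measure.infinitePi μ)).map
      (fun p : (∀ i, E i) × (∀ i, E i) => S.piecewise p.2 p.1) = Measure.infinitePi μ := by
  classical
  have hm := measurable_piecewise_prod (E := E) S
  refine Measure.eq_infinitePi μ fun s t ht => ?_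
  rw [Measure.map_apply hm (.pi s.countable_toSet fun i _ => ht i)]
  have e : (fun p : (∀ i, E i) × (∀ i, E i) => S.piecewise p.2 p.1) ⁻¹' (Set.pi s t)
      = (Set.pi (s.filter (· ∉ S)) t) ×ˢ (Set.pi (s.filter (· ∈ S)) t) := by
    ext p
    simp only [Set.mem_preimage, Set.mem_pi, Set.mem_prod, Finset.coe_filter, Finset.mem_coe,
      Set.mem_ofPred_eq, and_imp]
    constructor
    · intro h
      refine ⟨fun i hi hS => ?_, fun i hi hS => ?_⟩
      · simpa [Set.piecewise, hS] using h i hi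
      · simpa [Set.piecewise, hS] using h i hi
    · rintro ⟨h1, h2⟩ i hi
      by_cases hS : i ∈ S
      · simpa [Set.piecewise, hS] using h2 i hi hS
      · simpa [Set.piecewise, hS] using h1 i hi hS
  rw [e, Measure.prod_prod, Measure.infinitePi_pi _ fun i _ => ht i,
    Measure.infinitePi_pi _ fun i _ => ht i, mul_comm, Finset.prod_filter_mul_prod_filter_not]

/-- The indices `(n, k)` of the points `k / 2 ^ n` first appearing on level `n`. -/
abbrev OddIndex : Type := {p : ℕ × ℕ // Odd p.2 ∧ p.2 < 2 ^ p.1}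

/-- The uniform distribution on `[0, 1]`. -/
noncomputable def unifLaw : Measure ℝ := volume.restrict (Set.Icc 0 1)

instance : IsProbabilityMeasure unifLaw := ⟨by simp [unifLaw]⟩

/-- The law of a family of independent uniform variables indexed by `OddIndex`. -/
noncomputable def arrayLaw : Measure (OddIndex → ℝ) := Measure.infinitePi fun _ => unifLaw

instance : IsProbabilityMeasure arrayLaw := by unfold arrayLaw; infer_instance

/-- The total array with the entries `z`, truncated to `[0, 1]` and completed by the value `1 / 2`.
Almost surely the truncation changes nothing; it makes the entries lie in `[0, 1]` for every `z`. -/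
noncomputable def clampArray (z : OddIndex → ℝ) : ℕ → ℕ → ℝ := fun n k =>
  if h : Odd k ∧ k < 2 ^ n then max 0 (min 1 (z ⟨(n, k), h⟩)) else 1 / 2

lemma clampArray_of_index (z : OddIndex → ℝ) {n k : ℕ} (h : Odd k ∧ k < 2 ^ n) :
    clampArray z n k = max 0 (min 1 (z ⟨(n, k), h⟩)) := dif_pos h

lemma clampArray_mem (z : OddIndex → ℝ) (n k : ℕ) : clampArray z n k ∈ Set.Icc (0:ℝ) 1 := by
  unfold clampArray
  split_ifs
  · simp
  · norm_num

lemma measurable_clampArray (n k : ℕ) : Measurable fun z => clampArray z n k := by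
  unfold clampArray
  split_ifs
  · fun_prop
  · fun_prop

lemma measurable_dyadicValue_clampArray (n k : ℕ) :
    Measurable fun z => dyadicValue (clampArray z) n k := by
  induction n generalizing k with
  | zero => simp [dyadicValue]
  | succ n ih =>
    obtain ⟨j, rfl | rfl⟩ := Nat.even_or_odd' k
    · simp_rw [dyadicValue_even]; exact ih j
    · simp_rw [dyadicValue_odd]
      exact (ih j).add ((measurable_clampArray _ _).mul ((ih _).sub (ih j)))

lemma measurable_dyadicMap_clampArray :
    Measurable fun p : (OddIndex → ℝ) × ℝ => dyadicMap (clampArray p.1) p.2 := by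
  refine measurable_of_tendsto_metrizable (f := fun (n : ℕ) (p : (OddIndex → ℝ) × ℝ) =>
    dyadicValue (clampArray p.1) n ⌊2 ^ n * p.2⌋₊) (fun n => ?_)
    (tendsto_pi_nhds.2 fun p => tendsto_dyadicValue_floor (clampArray_mem p.1) p.2)
  have h1 : Measurable fun q : (OddIndex → ℝ) × ℕ => dyadicValue (clampArray q.1) n q.2 :=
    measurable_from_prod_countable_left fun k => measurable_dyadicValue_clampArray n k
  exact h1.comp (measurable_fst.prodMk (Nat.measurable_floor.comp (by fun_prop)))

lemma arrayLaw_map_eval (i : OddIndex) : arrayLaw.map (fun z => z i) = unifLaw :=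
  Measure.infinitePi_map_eval (fun _ => unifLaw) i

lemma integral_arrayLaw_eval {g : ℝ → ℝ} (hg : Measurable g) (i : OddIndex) :
    ∫ z, g (z i) ∂arrayLaw = ∫ v in Set.Icc (0:ℝ) 1, g v := by
  have := integral_map (μ := arrayLaw) (φ := fun z => z i) (by exact (measurable_pi_apply i).aemeasurable)
    (hg.aestronglyMeasurable (μ := arrayLaw.map (fun z => z i)))
  rw [← this, arrayLaw_map_eval, unifLaw]

lemma integral_arrayLaw_clampArray {g : ℝ → ℝ} (hg : Measurable g) {n k : ℕ}
    (h : Odd k ∧ k < 2 ^ n) :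
    ∫ z, g (clampArray z n k) ∂arrayLaw = ∫ v in Set.Icc (0:ℝ) 1, g v := by
  simp_rw [clampArray_of_index _ h]
  rw [integral_arrayLaw_eval (g := fun v => g (max 0 (min 1 v))) (hg.comp (by fun_prop))]
  refine setIntegral_congr_fun measurableSet_Icc fun v hv => ?_
  simp [hv.1, hv.2]

lemma arrayLaw_clampArray_lt_le {θ : ℝ} (hθ1 : θ ≤ 1 / 2) (n k : ℕ) :
    arrayLaw {z | clampArray z n k < θ} ≤ ENNReal.ofReal θ := by
  by_cases h : Odd k ∧ k < 2 ^ n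
  · have e : {z | clampArray z n k < θ} = (fun z : OddIndex → ℝ => z ⟨(n, k), h⟩) ⁻¹'
        {v | max 0 (min 1 v) < θ} := by ext z; simp [clampArray_of_index z h]
    have hm : MeasurableSet {v : ℝ | max 0 (min 1 v) < θ} :=
      measurableSet_lt (by fun_prop) (by fun_prop)
    rw [e, ← Measure.map_apply (by fun_prop) hm, arrayLaw_map_eval, unifLaw,
      Measure.restrict_apply hm]
    refine (measure_mono (t := Set.Ico 0 θ) ?_).trans (by simp)
    rintro v ⟨hv, hv0, hv1⟩
    simp only [Set.mem_ofPred_eq, min_eq_right hv1, max_eq_right hv0] at hv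
    exact ⟨hv0, hv⟩
  · have : {z | clampArray z n k < θ} = ∅ := by
      ext z; simp only [clampArray, dif_neg h, Set.mem_ofPred_eq, Set.mem_empty_iff_false, iff_false]
      linarith
    simp [this]

lemma arrayLaw_one_sub_lt_clampArray_le {θ : ℝ} (hθ1 : θ ≤ 1 / 2) (n k : ℕ) :
    arrayLaw {z | 1 - θ < clampArray z n k} ≤ ENNReal.ofReal θ := by
  by_cases h : Odd k ∧ k < 2 ^ n
  · have e : {z | 1 - θ < clampArray z n k} = (fun z : OddIndex → ℝ => z ⟨(n, k), h⟩) ⁻¹'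
        {v | 1 - θ < max 0 (min 1 v)} := by ext z; simp [clampArray_of_index z h]
    have hm : MeasurableSet {v : ℝ | 1 - θ < max 0 (min 1 v)} :=
      measurableSet_lt (by fun_prop) (by fun_prop)
    rw [e, ← Measure.map_apply (by fun_prop) hm, arrayLaw_map_eval, unifLaw,
      Measure.restrict_apply hm]
    refine (measure_mono (t := Set.Ioc (1 - θ) 1) ?_).trans (by simp)
    rintro v ⟨hv, hv0, hv1⟩
    simp only [Set.mem_ofPred_eq, min_eq_right hv1, max_eq_right hv0] at hv
    exact ⟨hv, hv1⟩
  · have : {z | 1 - θ < clampArray z n k} = ∅ := by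
      ext z; simp only [clampArray, dif_neg h, Set.mem_ofPred_eq, Set.mem_empty_iff_false, iff_false]
      linarith
    simp [this]

lemma ae_clampArray_mem_Ioo : ∀ᵐ z ∂arrayLaw, ∀ n k, clampArray z n k ∈ Set.Ioo (0:ℝ) 1 := by
  rw [ae_all_iff]; intro n; rw [ae_all_iff]; intro k
  have h0 : ∀ᵐ z ∂arrayLaw, clampArray z n k ≠ 0 := by
    rw [ae_iff]
    refine le_antisymm (ENNReal.le_of_forall_pos_le_add fun ε hε _ => ?_) zero_le
    have h1 := arrayLaw_clampArray_lt_le (θ := min ε (1 / 2)) (min_le_right _ _) n k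
    refine (measure_mono fun z hz => ?_).trans (h1.trans ?_)
    · simp only [ne_eq, not_not, Set.mem_ofPred_eq] at hz ⊢
      rw [hz]; exact lt_min (by exact_mod_cast hε) (by norm_num)
    · rw [zero_add, ← ENNReal.ofReal_coe_nnreal]
      exact ENNReal.ofReal_le_ofReal (min_le_left _ _)
  have h2 : ∀ᵐ z ∂arrayLaw, clampArray z n k ≠ 1 := by
    rw [ae_iff]
    refine le_antisymm (ENNReal.le_of_forall_pos_le_add fun ε hε _ => ?_) zero_le
    have h1 := arrayLaw_one_sub_lt_clampArray_le (θ := min ε (1 / 2)) (min_le_right _ _) n k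
    refine (measure_mono fun z hz => ?_).trans (h1.trans ?_)
    · simp only [ne_eq, not_not, Set.mem_ofPred_eq] at hz ⊢
      rw [hz]
      have : 0 < min (ε : ℝ) (1 / 2) := lt_min (by exact_mod_cast hε) (by norm_num)
      linarith
    · rw [zero_add, ← ENNReal.ofReal_coe_nnreal]
      exact ENNReal.ofReal_le_ofReal (min_le_left _ _)
  filter_upwards [h0, h2] with z hz0 hz1
  have := clampArray_mem z n k
  exact ⟨lt_of_le_of_ne this.1 (Ne.symm hz0), lt_of_le_of_ne this.2 hz1⟩

/-! ### The lengths of the images of dyadic intervals -/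

/-- The length of the image of the dyadic interval `[k / 2 ^ n, (k + 1) / 2 ^ n]`. -/
noncomputable def gap (x : ℕ → ℕ → ℝ) (n k : ℕ) : ℝ := dyadicValue x n (k + 1) - dyadicValue x n k

lemma clampArray_piecewise_of_notMem {S : Set OddIndex} [∀ i, Decidable (i ∈ S)] {n k : ℕ} (u z : OddIndex → ℝ)
    (h : ∀ i ∈ S, i.1 ≠ (n, k)) : clampArray (S.piecewise u z) n k = clampArray z n k := by
  unfold clampArray
  split_ifs with hi
  · have : (⟨(n, k), hi⟩ : OddIndex) ∉ S := fun hS => h _ hS rfl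
    rw [Set.piecewise_eq_of_notMem _ _ _ this]
  · rfl

lemma clampArray_piecewise_of_mem {S : Set OddIndex} [∀ i, Decidable (i ∈ S)] {n k : ℕ} (u z : OddIndex → ℝ)
    (hi : Odd k ∧ k < 2 ^ n) (h : (⟨(n, k), hi⟩ : OddIndex) ∈ S) :
    clampArray (S.piecewise u z) n k = clampArray u n k := by
  rw [clampArray_of_index _ hi, clampArray_of_index _ hi, Set.piecewise_eq_of_mem _ _ _ h]

lemma integral_mul_clampArray_succ {F : (OddIndex → ℝ) → ℝ} (hF : Measurable F) {g : ℝ → ℝ}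
    (hg : Measurable g) {n j : ℕ} (hj : j < 2 ^ n)
    (hFn : ∀ z u, (∀ m ≤ n, ∀ k, clampArray z m k = clampArray u m k) → F z = F u) :
    ∫ z, F z * g (clampArray z (n + 1) (2 * j + 1)) ∂arrayLaw
      = (∫ z, F z ∂arrayLaw) * ∫ v in Set.Icc (0:ℝ) 1, g v := by
  classical
  have hi : Odd (2 * j + 1) ∧ 2 * j + 1 < 2 ^ (n + 1) := ⟨by simp, by rw [pow_succ]; omega⟩
  set S : Set OddIndex := {⟨(n + 1, 2 * j + 1), hi⟩} with hS
  have hmp := infinitePi_map_piecewise (fun _ : OddIndex => unifLaw) S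
  change (arrayLaw.prod arrayLaw).map _ = arrayLaw at hmp
  have hm := measurable_piecewise_prod (E := fun _ : OddIndex => ℝ) S
  have hmeas : Measurable fun z => F z * g (clampArray z (n + 1) (2 * j + 1)) :=
    hF.mul (hg.comp (measurable_clampArray _ _))
  conv_lhs => rw [← hmp]
  rw [integral_map hm.aemeasurable hmeas.aestronglyMeasurable, ← integral_arrayLaw_clampArray hg hi,
    ← integral_prod_mul]
  congr 1
  ext p
  rw [clampArray_piecewise_of_mem _ _ hi (by simp [hS])]
  congr 1
  refine hFn _ _ fun m hmn k => clampArray_piecewise_of_notMem _ _ fun i hi => ?_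
  simp only [hS, Set.mem_singleton_iff] at hi
  rw [hi]
  intro h
  have := congrArg Prod.fst h
  simp at this
  omega

lemma integral_gap_sq {n k : ℕ} (hk : k < 2 ^ n) :
    ∫ z, gap (clampArray z) n k ^ 2 ∂arrayLaw = (1 / 3) ^ n := by
  induction n generalizing k with
  | zero => simp at hk; simp [gap, dyadicValue, hk]
  | succ n ih =>
    rw [pow_succ] at hk
    have hF : ∀ j, Measurable fun z => gap (clampArray z) n j ^ 2 := fun j =>
      ((measurable_dyadicValue_clampArray _ _).sub (measurable_dyadicValue_clampArray _ _)).pow_const 2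
    have hFn : ∀ j, ∀ z u : OddIndex → ℝ,
        (∀ m ≤ n, ∀ k, clampArray z m k = clampArray u m k) →
        gap (clampArray z) n j ^ 2 = gap (clampArray u) n j ^ 2 := by
      intro j z u h
      simp only [gap, dyadicValue_congr_of_level_le h]
    obtain ⟨j, rfl | rfl⟩ := Nat.even_or_odd' k
    · have e : ∀ z, gap (clampArray z) (n + 1) (2 * j) ^ 2
          = gap (clampArray z) n j ^ 2 * (clampArray z (n + 1) (2 * j + 1)) ^ 2 := by
        intro z; simp only [gap, dyadicValue_odd, dyadicValue_even]; ring
      simp_rw [e]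
      rw [integral_mul_clampArray_succ (hF j) (g := fun v => v ^ 2) (by fun_prop) (by omega) (hFn j),
        ih (by omega), integral_Icc_eq_integral_Ioc, ← intervalIntegral.integral_of_le zero_le_one,
        integral_pow]
      norm_num [pow_succ]
    · have e : ∀ z, gap (clampArray z) (n + 1) (2 * j + 1) ^ 2
          = gap (clampArray z) n j ^ 2 * (1 - clampArray z (n + 1) (2 * j + 1)) ^ 2 := by
        intro z
        simp only [gap]
        rw [show 2 * j + 1 + 1 = 2 * (j + 1) by ring, dyadicValue_odd, dyadicValue_even]; ring
      simp_rw [e]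
      rw [integral_mul_clampArray_succ (hF j) (g := fun v => (1 - v) ^ 2) (by fun_prop) (by omega) (hFn j),
        ih (by omega), integral_Icc_eq_integral_Ioc, ← intervalIntegral.integral_of_le zero_le_one,
        intervalIntegral.integral_comp_sub_left (fun v => v ^ 2), integral_pow]
      norm_num [pow_succ]

/-- Almost surely the images of the dyadic intervals of level `n` are exponentially short. -/
lemma ae_eventually_gap_lt :
    ∀ᵐ z ∂arrayLaw, ∀ᶠ n in atTop, ∀ k < 2 ^ n, gap (clampArray z) n k < (9 / 10) ^ n := by
  have hgm : ∀ n k, Measurable fun z => gap (clampArray z) n k := fun n k =>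
    (measurable_dyadicValue_clampArray _ _).sub (measurable_dyadicValue_clampArray _ _)
  have hg : ∀ z n k, gap (clampArray z) n k ∈ Set.Icc (0:ℝ) 1 := fun z n k =>
    ⟨sub_nonneg.2 (dyadicValue_mono (clampArray_mem z) n (Nat.le_succ k)), by
      have := dyadicValue_le_one (clampArray_mem z) n (k + 1)
      have := dyadicValue_nonneg (clampArray_mem z) n k
      unfold gap; linarith⟩
  have hone : ∀ n, ∀ k < 2 ^ n, arrayLaw {z | (9 / 10) ^ n ≤ gap (clampArray z) n k}
      ≤ ENNReal.ofReal ((100 / 243) ^ n) := by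
    intro n k hk
    have hint : Integrable (fun z => gap (clampArray z) n k ^ 2) arrayLaw := by
      refine Integrable.of_bound ((hgm n k).pow_const 2).aestronglyMeasurable 1
        (ae_of_all _ fun z => ?_)
      rw [Real.norm_of_nonneg (by positivity)]
      exact pow_le_one₀ (hg z n k).1 (hg z n k).2
    have h1 := mul_meas_ge_le_integral_of_nonneg (ae_of_all _ fun z => sq_nonneg _) hint
      (((9 / 10) ^ n) ^ 2)
    rw [integral_gap_sq hk] at h1
    have h2 : arrayLaw.real {z | (9 / 10) ^ n ≤ gap (clampArray z) n k} ≤ (100 / 243) ^ n := by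
      have h3 : {z | (9 / 10) ^ n ≤ gap (clampArray z) n k}
          ⊆ {z | (((9:ℝ) / 10) ^ n) ^ 2 ≤ gap (clampArray z) n k ^ 2} := by
        intro z hz
        exact pow_le_pow_left₀ (by positivity : (0:ℝ) ≤ (9 / 10) ^ n) hz 2
      have h4 := measureReal_mono (μ := arrayLaw) h3
      have h5 : (0:ℝ) < (((9:ℝ) / 10) ^ n) ^ 2 := by positivity
      have h6 : ((100:ℝ) / 243) ^ n = (1 / 3) ^ n / (((9:ℝ) / 10) ^ n) ^ 2 := by
        rw [← pow_mul, mul_comm n 2, pow_mul, ← div_pow]; norm_num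
      rw [h6, le_div_iff₀ h5, mul_comm]
      exact (mul_le_mul_of_nonneg_left h4 h5.le).trans h1
    rw [← ENNReal.ofReal_toReal (measure_ne_top arrayLaw _)]
    exact ENNReal.ofReal_le_ofReal h2
  have hlev : ∀ n, arrayLaw (⋃ k ∈ Finset.range (2 ^ n), {z | (9 / 10) ^ n ≤ gap (clampArray z) n k})
      ≤ ENNReal.ofReal ((200 / 243) ^ n) := by
    intro n
    refine (measure_biUnion_finset_le _ _).trans ((Finset.sum_le_sum fun k hk =>
      hone n k (Finset.mem_range.1 hk)).trans ?_)
    rw [Finset.sum_const, Finset.card_range, ← ENNReal.ofReal_nsmul]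
    refine ENNReal.ofReal_le_ofReal (le_of_eq ?_)
    rw [nsmul_eq_mul]; push_cast; rw [← mul_pow]; norm_num
  have hsum : ∑' n, arrayLaw (⋃ k ∈ Finset.range (2 ^ n),
      {z | (9 / 10) ^ n ≤ gap (clampArray z) n k}) ≠ ⊤ := by
    refine ne_top_of_le_ne_top ?_ (ENNReal.tsum_le_tsum hlev)
    rw [← ENNReal.ofReal_tsum_of_nonneg (fun n => by positivity)
      (summable_geometric_of_lt_one (by norm_num) (by norm_num))]
    exact ENNReal.ofReal_ne_top
  filter_upwards [ae_eventually_notMem hsum] with z hz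
  filter_upwards [hz] with n hn k hk
  simp only [Set.mem_iUnion, Finset.mem_range, Set.mem_ofPred_eq, not_exists, not_le] at hn
  exact hn k hk

lemma gapsVanish_of_eventually_lt {x : ℕ → ℕ → ℝ}
    (h : ∀ᶠ n in atTop, ∀ k < 2 ^ n, gap x n k < (9 / 10) ^ n) : GapsVanish x := by
  intro ε hε
  have h1 : ∀ᶠ n : ℕ in atTop, ((9:ℝ) / 10) ^ n < ε :=
    (tendsto_pow_atTop_nhds_zero_of_lt_one (by norm_num) (by norm_num)).eventually_lt_const hε
  obtain ⟨n, hn, hn'⟩ := (h.and h1).exists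
  exact ⟨n, fun k hk => (hn k hk).trans hn'⟩

/-! ### Concentration of the integral over one dyadic block -/

/-- Hoeffding's inequality for independent variables bounded by `b`, two-sided. -/
lemma measureReal_lt_abs_sum_sub_integral_le {Ω ι : Type*} [MeasurableSpace Ω] {P : Measure Ω}
    [IsProbabilityMeasure P] {Y : ι → Ω → ℝ} (hY : iIndepFun Y P) (hm : ∀ i, Measurable (Y i))
    {b : ℝ} (hb : ∀ i ω, |Y i ω| ≤ b) (s : Finset ι) {ε : ℝ} (hε : 0 ≤ ε) :
    P.real {ω | ε < |∑ i ∈ s, (Y i ω - ∫ ω', Y i ω' ∂P)|}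
      ≤ 2 * Real.exp (-ε ^ 2 / (2 * (s.card * b ^ 2))) := by
  have hsub : ∀ i, HasSubgaussianMGF (fun ω => Y i ω - ∫ ω', Y i ω' ∂P)
      ((‖b - -b‖₊ / 2) ^ 2) P := fun i =>
    hasSubgaussianMGF_of_mem_Icc (hm i).aemeasurable (ae_of_all _ fun ω => abs_le.1 (hb i ω))
  have hc : (((‖b - -b‖₊ / 2) ^ 2 : NNReal) : ℝ) = b ^ 2 := by
    simp only [NNReal.coe_pow, NNReal.coe_div, coe_nnnorm, NNReal.coe_ofNat, Real.norm_eq_abs,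
      div_pow, sq_abs]
    ring
  have hind : iIndepFun (fun i ω => Y i ω - ∫ ω', Y i ω' ∂P) P :=
    hY.comp (fun i y => y - ∫ ω', Y i ω' ∂P) fun i => by fun_prop
  have hind' : iIndepFun (fun i ω => -(Y i ω - ∫ ω', Y i ω' ∂P)) P :=
    hind.comp (fun _ y => -y) fun i => by fun_prop
  have h1 := HasSubgaussianMGF.measure_sum_ge_le_of_iIndepFun hind (s := s)
    (fun i _ => hsub i) hε
  have h2 := HasSubgaussianMGF.measure_sum_ge_le_of_iIndepFun hind' (s := s)
    (fun i _ => (hsub i).neg) hε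
  simp only [Finset.sum_const, nsmul_eq_mul] at h1 h2
  rw [NNReal.coe_mul, NNReal.coe_natCast, hc] at h1 h2
  calc _ ≤ P.real ({ω | ε ≤ ∑ i ∈ s, (Y i ω - ∫ ω', Y i ω' ∂P)} ∪
        {ω | ε ≤ ∑ i ∈ s, -(Y i ω - ∫ ω', Y i ω' ∂P)}) := by
        refine measureReal_mono fun ω hω => ?_
        rcases lt_abs.1 (Set.mem_ofPred_eq ▸ hω) with h | h
        · exact Or.inl h.le
        · refine Or.inr ?_
          simp only [Set.mem_ofPred_eq]
          rw [Finset.sum_neg_distrib]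
          exact h.le
    _ ≤ _ := (measureReal_union_le _ _).trans (by linarith)

/-- The integral of `h ∘ φ` against the Dirichlet kernel over `[2 ^ (-m-1), 2 ^ (-m)]`. -/
noncomputable def blockIntegral (h : ℝ → ℝ) (n m : ℕ) (x : ℕ → ℕ → ℝ) : ℝ :=
  ∫ t in (1:ℝ) / 2 ^ (m + 1)..1 / 2 ^ m, h (dyadicMap x t) * dirichletKer n t

/-- For the level-`L` dyadic intervals `k ∈ [A, B)`, the variables governing their first and last
subintervals on the next `q` levels do not make these shorter than by a factor `θ` per level. -/
def EndsWide (x : ℕ → ℕ → ℝ) (θ : ℝ) (L A B q : ℕ) : Prop :=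
  ∀ k ∈ Finset.Ico A B, ∀ i ∈ Finset.Icc 1 q,
    θ ≤ subtree x L k i 1 ∧ subtree x L k i (2 ^ i - 1) ≤ 1 - θ

lemma measurableSet_endsWide (θ : ℝ) (L A B q : ℕ) :
    MeasurableSet {z | EndsWide (clampArray z) θ L A B q} := by
  have : {z | EndsWide (clampArray z) θ L A B q} = ⋂ k ∈ Finset.Ico A B, ⋂ i ∈ Finset.Icc 1 q,
      {z | θ ≤ subtree (clampArray z) L k i 1 ∧ subtree (clampArray z) L k i (2 ^ i - 1) ≤ 1 - θ} := by
    ext z; simp only [EndsWide, Set.mem_ofPred_eq, Set.mem_iInter]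
  rw [this]
  refine Finset.measurableSet_biInter _ fun k _ => Finset.measurableSet_biInter _ fun i _ => ?_
  exact (measurableSet_le measurable_const (measurable_clampArray _ _)).inter
    (measurableSet_le (measurable_clampArray _ _) measurable_const)

lemma arrayLaw_not_endsWide_le {θ : ℝ} (hθ0 : 0 ≤ θ) (hθ : θ ≤ 1 / 2) (L A B q : ℕ) :
    arrayLaw {z | ¬ EndsWide (clampArray z) θ L A B q}
      ≤ ENNReal.ofReal ((B - A : ℕ) * (q * (2 * θ))) := by
  have hsub : {z | ¬ EndsWide (clampArray z) θ L A B q} ⊆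
      ⋃ k ∈ Finset.Ico A B, ⋃ i ∈ Finset.Icc 1 q, ({z | subtree (clampArray z) L k i 1 < θ} ∪
        {z | 1 - θ < subtree (clampArray z) L k i (2 ^ i - 1)}) := by
    intro z hz
    simp only [EndsWide, Set.mem_ofPred_eq, not_forall, not_and_or, not_le] at hz
    obtain ⟨k, hk, i, hi, h⟩ := hz
    simp only [Set.mem_iUnion]
    exact ⟨k, hk, i, hi, h⟩
  refine (measure_mono hsub).trans ((measure_biUnion_finset_le _ _).trans ?_)
  have h1 : ∀ k ∈ Finset.Ico A B, arrayLaw (⋃ i ∈ Finset.Icc 1 q,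
      ({z | subtree (clampArray z) L k i 1 < θ} ∪
        {z | 1 - θ < subtree (clampArray z) L k i (2 ^ i - 1)})) ≤ ENNReal.ofReal (q * (2 * θ)) := by
    intro k _
    refine (measure_biUnion_finset_le _ _).trans ?_
    have h2 : ∀ i ∈ Finset.Icc 1 q, arrayLaw ({z | subtree (clampArray z) L k i 1 < θ} ∪
        {z | 1 - θ < subtree (clampArray z) L k i (2 ^ i - 1)}) ≤ ENNReal.ofReal (2 * θ) := by
      intro i _
      refine (measure_union_le _ _).trans ?_
      rw [two_mul, ENNReal.ofReal_add hθ0 hθ0]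
      exact add_le_add (arrayLaw_clampArray_lt_le hθ _ _) (arrayLaw_one_sub_lt_clampArray_le hθ _ _)
    refine (Finset.sum_le_sum h2).trans (le_of_eq ?_)
    rw [Finset.sum_const, ← ENNReal.ofReal_nsmul, nsmul_eq_mul]
    simp
  refine (Finset.sum_le_sum h1).trans (le_of_eq ?_)
  rw [Finset.sum_const, ← ENNReal.ofReal_nsmul, nsmul_eq_mul]
  simp

lemma measurable_blockIntegral {h : ℝ → ℝ} (hh : Measurable h) (n m : ℕ) :
    Measurable fun z => blockIntegral h n m (clampArray z) := by
  have hle : (1:ℝ) / 2 ^ (m + 1) ≤ 1 / 2 ^ m :=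
    one_div_le_one_div_of_le (by positivity) (pow_le_pow_right₀ one_le_two (Nat.le_succ m))
  simp only [blockIntegral, intervalIntegral.integral_of_le hle]
  refine StronglyMeasurable.measurable (StronglyMeasurable.integral_prod_right ?_)
  refine Measurable.stronglyMeasurable ?_
  exact (hh.comp measurable_dyadicMap_clampArray).mul
    ((continuous_dirichletKer n).measurable.comp measurable_snd)

section Block

variable {h : ℝ → ℝ} {n m p : ℕ}

lemma blockIntegral_eq_sum_cellIntegral (hh : Measurable h) (hh1 : ∀ y, |h y| ≤ 1)
    {x : ℕ → ℕ → ℝ} (hx : ∀ n k, x n k ∈ Set.Icc (0:ℝ) 1) (n m r : ℕ) :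
    blockIntegral h n m x = ∑ k ∈ Finset.Ico (2 ^ r) (2 ^ (r + 1)),
      cellIntegral h (dirichletKer n) x (m + 1 + r) k (x (m + 1 + r + 1) (2 * k + 1)) := by
  have hc := continuous_dirichletKer n
  have hsum := intervalIntegral.sum_integral_adjacent_intervals_Ico (μ := volume)
    (f := fun t => h (dyadicMap x t) * dirichletKer n t)
    (a := fun k : ℕ => (k : ℝ) / 2 ^ (m + 1 + r)) (m := 2 ^ r) (n := 2 ^ (r + 1))
    (Nat.pow_le_pow_right two_pos (Nat.le_succ r))
    (fun k _ => intervalIntegrable_dyadicMap_comp hh hh1 hc hx _ _)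
  have e1 : (((2 ^ r : ℕ) : ℝ)) / 2 ^ (m + 1 + r) = 1 / 2 ^ (m + 1) := by
    push_cast; rw [pow_add 2 (m + 1) r]; field_simp
  have e2 : (((2 ^ (r + 1) : ℕ) : ℝ)) / 2 ^ (m + 1 + r) = 1 / 2 ^ m := by
    push_cast; rw [show m + 1 + r = m + (r + 1) by ring, pow_add 2 m (r + 1)]; field_simp
  simp only [e1, e2] at hsum
  rw [blockIntegral, ← hsum]
  exact Finset.sum_congr rfl fun k _ => (cellIntegral_self hh hh1 hc hx).symm

lemma mem_Icc_of_mem_cell (hm : 1 ≤ m) {r k : ℕ} (hk : k ∈ Finset.Ico (2 ^ r) (2 ^ (r + 1)))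
    {t : ℝ} (ht : t ∈ Set.Icc ((k : ℝ) / 2 ^ (m + 1 + r)) ((k + 1) / 2 ^ (m + 1 + r))) :
    1 / 2 ^ (m + 1) ≤ t ∧ t ≤ 1 / 2 := by
  rw [Finset.mem_Ico] at hk
  have h1 : ((2 ^ r : ℕ) : ℝ) ≤ k := by exact_mod_cast hk.1
  have h2 : ((k : ℝ) + 1) ≤ ((2 ^ (r + 1) : ℕ) : ℝ) := by exact_mod_cast hk.2
  have e1 : (((2 ^ r : ℕ) : ℝ)) / 2 ^ (m + 1 + r) = 1 / 2 ^ (m + 1) := by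
    push_cast; rw [pow_add 2 (m + 1) r]; field_simp
  have e2 : (((2 ^ (r + 1) : ℕ) : ℝ)) / 2 ^ (m + 1 + r) = 1 / 2 ^ m := by
    push_cast; rw [show m + 1 + r = m + (r + 1) by ring, pow_add 2 m (r + 1)]; field_simp
  constructor
  · rw [← e1]; refine le_trans ?_ ht.1; gcongr
  · refine ht.2.trans ?_
    calc ((k : ℝ) + 1) / 2 ^ (m + 1 + r) ≤ ((2 ^ (r + 1) : ℕ) : ℝ) / 2 ^ (m + 1 + r) := by gcongr
      _ = 1 / 2 ^ m := e2
      _ ≤ 1 / 2 ^ 1 := one_div_le_one_div_of_le (by norm_num) (pow_le_pow_right₀ one_le_two hm)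
      _ = 1 / 2 := by norm_num

/-- Given the variables outside level `m + 2 + 4 p`, the integral over the block is a sum of
independent variables, one for each of `2 ^ (4 p)` cells. Their means are small since the kernel
oscillates within the cells, and the sum is close to its mean by Hoeffding's inequality. -/
lemma arrayLaw_blockIntegral_piecewise_le (hh : Measurable h) (hh1 : ∀ y, |h y| ≤ 1) (hm : 1 ≤ m)
    (hn : 2 ^ (m + 8 * p) ≤ n) (S : Set OddIndex) [∀ i, Decidable (i ∈ S)]
    (hS : S = {i | i.1.1 = m + 1 + 4 * p + 1}) {z : OddIndex → ℝ}
    (hz : EndsWide (clampArray z) (Real.exp (-4 ^ p)) (m + 1 + 4 * p + 1)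
      (2 ^ (4 * p + 1)) (2 ^ (4 * p + 2)) p) :
    arrayLaw.real {u | 6 * (1 / 2) ^ p < |blockIntegral h n m (clampArray (S.piecewise u z))|}
      ≤ 2 * Real.exp (-2 * 4 ^ p) := by
  set r := 4 * p with hr
  set R := m + 1 + r with hR
  set w := dirichletKer n with hw
  have hwc : Continuous w := continuous_dirichletKer n
  set s := Finset.Ico (2 ^ r) (2 ^ (r + 1)) with hs
  set x := clampArray z with hx
  have hxm : ∀ n k, x n k ∈ Set.Icc (0:ℝ) 1 := clampArray_mem z
  set Z : ℕ → ℝ → ℝ := fun k v => cellIntegral h w x R k v with hZ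
  have hodd : ∀ k ∈ s, Odd (2 * k + 1) ∧ 2 * k + 1 < 2 ^ (R + 1) := by
    intro k hk
    refine ⟨by simp, ?_⟩
    have h1 : k < 2 ^ (r + 1) := (Finset.mem_Ico.1 hk).2
    have h2 : 2 ^ (r + 1) ≤ 2 ^ R := Nat.pow_le_pow_right two_pos (by omega)
    rw [pow_succ]; omega
  have h2m : (0:ℝ) < 2 ^ m := by positivity
  -- pointwise bound and cancellation for the kernel on the cells
  have hW : ∀ k ∈ s, ∀ t ∈ Set.Icc ((k : ℝ) / 2 ^ R) ((k + 1) / 2 ^ R), |w t| ≤ 2 ^ m := by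
    intro k hk t ht
    obtain ⟨h1, h2⟩ := mem_Icc_of_mem_cell hm hk ht
    have h0 : (0:ℝ) < 1 / 2 ^ (m + 1) := by positivity
    refine (abs_dirichletKer_le_inv n (h0.trans_le h1) h2).trans ?_
    calc (2 * t)⁻¹ ≤ (2 * (1 / 2 ^ (m + 1)))⁻¹ := by gcongr
      _ = 2 ^ m := by rw [pow_succ]; field_simp
  have hK : ∀ k ∈ s, ∀ a b, (k : ℝ) / 2 ^ R ≤ a → a ≤ b → b ≤ (k + 1) / 2 ^ R →
      |∫ u in a..b, w u| ≤ (1 / 2) ^ (8 * p) := by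
    intro k hk a b ha hab hb
    obtain ⟨h1, -⟩ := mem_Icc_of_mem_cell hm hk ⟨ha, hab.trans hb⟩
    obtain ⟨-, h2⟩ := mem_Icc_of_mem_cell hm hk ⟨ha.trans hab, hb⟩
    have h0 : (0:ℝ) < 1 / 2 ^ (m + 1) := by positivity
    refine (abs_integral_dirichletKer_le n (h0.trans_le h1) hab h2).trans ?_
    have hn' : (2:ℝ) ^ (m + 8 * p) ≤ n := by exact_mod_cast hn
    have ha0 : 0 < a := h0.trans_le h1
    have hn2 : 2 * (2:ℝ) ^ (m + 8 * p) ≤ 2 * n + 1 := by linarith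
    calc (a * (2 * n + 1))⁻¹ ≤ (1 / 2 ^ (m + 1) * (2 * 2 ^ (m + 8 * p)))⁻¹ := by
          gcongr
      _ = (1 / 2) ^ (8 * p) := by
          rw [pow_succ, pow_add, div_pow, one_pow]; field_simp
  -- the mean of the sum
  have hmean : ∀ k ∈ s, |∫ v in Set.Icc (0:ℝ) 1, Z k v|
      ≤ 2 * (2 ^ m * (1 / 2 ^ (R + 1 + p)) + (1 / 2) ^ (8 * p) * (1 + p * 4 ^ p)) := by
    intro k hk
    have hk' := Finset.mem_Ico.1 hk
    have c1 : 2 * k ∈ Finset.Ico (2 ^ (r + 1)) (2 ^ (r + 2)) := by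
      rw [Finset.mem_Ico, pow_succ, pow_succ _ (r + 1)]; omega
    have c2 : 2 * k + 1 ∈ Finset.Ico (2 ^ (r + 1)) (2 ^ (r + 2)) := by
      rw [Finset.mem_Ico, pow_succ, pow_succ _ (r + 1)]
      have := pow_succ 2 r
      omega
    have hl := pow_le_dyadicValue_one (Real.exp_pos (-4 ^ p)).le p
      (x := subtree x (R + 1) (2 * k)) fun i hi => (hz _ c1 i hi).1
    have hr' := pow_le_one_sub_dyadicValue (Real.exp_pos (-4 ^ p)).le p
      (x := subtree x (R + 1) (2 * k + 1)) fun i hi => (hz _ c2 i hi).2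
    have key := abs_integral_cellIntegral_le hh hh1 hwc hxm p (pow_pos (Real.exp_pos (-4 ^ p)) p)
      (hW k hk) (hK k hk) hl hr'
    have e : Real.log (1 / Real.exp (-4 ^ p) ^ p) = p * 4 ^ p := by
      rw [one_div, Real.log_inv, Real.log_pow, Real.log_exp]; ring
    rwa [e] at key
  have hcard : (s.card : ℝ) = 2 ^ r := by
    rw [hs, Nat.card_Ico, pow_succ, show 2 ^ r * 2 - 2 ^ r = 2 ^ r by omega]; push_cast; rfl
  have hsummean : |∑ k ∈ s, ∫ v in Set.Icc (0:ℝ) 1, Z k v| ≤ 5 * (1 / 2) ^ p := by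
    refine (Finset.abs_sum_le_sum_abs _ _).trans ((Finset.sum_le_sum hmean).trans ?_)
    rw [Finset.sum_const, nsmul_eq_mul, hcard]
    have hp : (p : ℝ) ≤ 2 ^ p := by exact_mod_cast Nat.lt_two_pow_self.le
    set a : ℝ := (1 / 2) ^ p with ha
    have ha0 : 0 < a := by positivity
    have ha1 : a ≤ 1 := pow_le_one₀ (by norm_num) (by norm_num)
    have e2 : (2:ℝ) ^ p = a⁻¹ := by rw [ha, ← inv_pow]; norm_num
    have e4 : (4:ℝ) ^ p = a⁻¹ ^ 2 := by
      rw [← e2, ← pow_mul, mul_comm, pow_mul]; norm_num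
    have er : (2:ℝ) ^ r = a⁻¹ ^ 4 := by rw [← e2, ← pow_mul, mul_comm p 4]
    have e8 : ((1:ℝ) / 2) ^ (8 * p) = a ^ 8 := by rw [ha, ← pow_mul, mul_comm 8 p]
    have eR : (2:ℝ) ^ (R + 1 + p) = 2 ^ m * 4 * a⁻¹ ^ 4 * a⁻¹ := by
      rw [hR, ← e2, ← pow_mul, mul_comm p 4, ← hr]; ring
    rw [e8, er, e4, eR]
    rw [e2] at hp
    have h1 : (p : ℝ) * a ≤ 1 := by
      calc (p:ℝ) * a ≤ a⁻¹ * a := by gcongr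
        _ = 1 := inv_mul_cancel₀ ha0.ne'
    have e3 : a⁻¹ ^ 4 * (2 * (2 ^ m * (1 / (2 ^ m * 4 * a⁻¹ ^ 4 * a⁻¹)) + a ^ 8 * (1 + p * a⁻¹ ^ 2)))
        = a / 2 + 2 * a ^ 4 + 2 * (p * a) * a := by
      field_simp; ring
    rw [e3]
    have h3 : a ^ 4 ≤ a := pow_le_of_le_one ha0.le ha1 (by norm_num)
    nlinarith
  -- independence of the summands under resampling
  let g : {k // k ∈ s} → OddIndex := fun k => ⟨(R + 1, 2 * k.1 + 1), hodd k.1 k.2⟩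
  have hg : Function.Injective g := by
    intro k k' hkk
    have := congrArg (fun i : OddIndex => i.1.2) hkk
    simp only [g] at this
    exact Subtype.ext (by omega)
  let Y : {k // k ∈ s} → (OddIndex → ℝ) → ℝ := fun k u => Z k.1 (clampArray u (R + 1) (2 * k.1 + 1))
  have hZm : ∀ k, Measurable (Z k) := fun k => measurable_cellIntegral hh hwc hxm R k
  have hYm : ∀ k, Measurable (Y k) := fun k => (hZm k.1).comp (measurable_clampArray _ _)
  have hYind : iIndepFun Y arrayLaw := by
    have h0 : iIndepFun (fun (i : OddIndex) (u : OddIndex → ℝ) => u i) arrayLaw :=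
      iIndepFun_infinitePi (P := fun _ : OddIndex => unifLaw) (X := fun _ v => v)
        (fun _ => measurable_id)
    have h1 := (h0.precomp hg).comp (fun k v => Z k.1 (max 0 (min 1 v)))
      fun k => (hZm k.1).comp (by fun_prop)
    convert h1 using 2 with k
    ext u
    simp only [Y, Function.comp, g]
    rw [clampArray_of_index u (hodd k.1 k.2)]
  have hYb : ∀ k u, |Y k u| ≤ 2 ^ m * (1 / 2 ^ R) := fun k u =>
    abs_cellIntegral_le hh1 (hW k.1 k.2) _
  have hYmean : ∀ k, ∫ u, Y k u ∂arrayLaw = ∫ v in Set.Icc (0:ℝ) 1, Z k.1 v := fun k =>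
    integral_arrayLaw_clampArray (hZm k.1) (hodd k.1 k.2)
  have hblock : ∀ u, blockIntegral h n m (clampArray (S.piecewise u z))
      = ∑ k : {k // k ∈ s}, Y k u := by
    intro u
    rw [blockIntegral_eq_sum_cellIntegral hh hh1 (clampArray_mem _) n m r, ← Finset.sum_coe_sort]
    refine Finset.sum_congr rfl fun k _ => ?_
    have h1 : ∀ n k, n ≠ R + 1 → clampArray (S.piecewise u z) n k = x n k := by
      intro n k hn
      refine clampArray_piecewise_of_notMem u z fun i hi h => ?_
      rw [hS] at hi
      exact hn (by rw [← hi, h])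
    rw [clampArray_piecewise_of_mem u z (hodd k.1 k.2) (by rw [hS]; exact rfl)]
    exact cellIntegral_congr h1 _
  have hoeff := measureReal_lt_abs_sum_sub_integral_le hYind hYm hYb Finset.univ
    (ε := (1 / 2) ^ p) (by positivity)
  have hexp : -((1 / 2 : ℝ) ^ p) ^ 2 /
      (2 * (((Finset.univ : Finset {k // k ∈ s}).card : ℝ) * (2 ^ m * (1 / 2 ^ R)) ^ 2))
      = -2 * 4 ^ p := by
    rw [Finset.card_univ, Fintype.card_coe, hcard]
    have e2 : (2:ℝ) ^ R = 2 ^ m * 2 * 2 ^ r := by rw [hR]; ring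
    have e3 : (2:ℝ) ^ r = (4 ^ p) ^ 2 := by
      rw [hr, ← pow_mul, show (4:ℝ) = 2 ^ 2 by norm_num, ← pow_mul]; congr 1; ring
    have e4 : ((1 / 2 : ℝ) ^ p) ^ 2 = 1 / 4 ^ p := by
      rw [← pow_mul, mul_comm, pow_mul, show ((1:ℝ) / 2) ^ 2 = 1 / 4 by norm_num, one_div_pow]
    rw [e2, e3, e4]
    field_simp
  rw [hexp] at hoeff
  refine le_trans (measureReal_mono fun u hu => ?_) hoeff
  simp only [Set.mem_ofPred_eq] at hu ⊢
  rw [hblock] at hu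
  rw [Finset.sum_sub_distrib]
  simp_rw [hYmean]
  rw [Finset.sum_coe_sort s (fun k => ∫ v in Set.Icc (0:ℝ) 1, Z k v)]
  have h3 := abs_sub_abs_le_abs_sub (∑ k : {k // k ∈ s}, Y k u)
    (∑ k ∈ s, ∫ v in Set.Icc (0:ℝ) 1, Z k v)
  linarith

/-- The integral over the block `[2 ^ (-m-1), 2 ^ (-m)]` against a kernel of frequency at least
`2 ^ (m + 8 p)` is `O (2 ^ (-p))`, up to a probability doubly exponentially small in `p`. -/
lemma arrayLaw_blockIntegral_le (hh : Measurable h) (hh1 : ∀ y, |h y| ≤ 1) (hm : 1 ≤ m)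
    (hp : 1 ≤ p) (hn : 2 ^ (m + 8 * p) ≤ n) :
    arrayLaw {z | 6 * (1 / 2) ^ p < |blockIntegral h n m (clampArray z)|}
      ≤ ENNReal.ofReal (2 ^ (5 * p + 3) * Real.exp (-4 ^ p)) := by
  classical
  set S : Set OddIndex := {i | i.1.1 = m + 1 + 4 * p + 1} with hS
  set L := m + 1 + 4 * p + 1 with hL
  set θ := Real.exp (-4 ^ p) with hθ
  set G : Set (OddIndex → ℝ) := {z | EndsWide (clampArray z) θ L (2 ^ (4 * p + 1)) (2 ^ (4 * p + 2)) p}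
    with hG
  set A : Set (OddIndex → ℝ) := {z | 6 * (1 / 2) ^ p < |blockIntegral h n m (clampArray z)|} with hA
  have hGm : MeasurableSet G := measurableSet_endsWide _ _ _ _ _
  have hAm : MeasurableSet A := measurableSet_lt measurable_const
    (measurable_blockIntegral hh n m).abs
  have hpw := measurable_piecewise_prod (E := fun _ : OddIndex => ℝ) S
  have hmp := infinitePi_map_piecewise (fun _ : OddIndex => unifLaw) S
  change (arrayLaw.prod arrayLaw).map _ = arrayLaw at hmp
  have hinv : ∀ z u, S.piecewise u z ∈ G → z ∈ G := by
    intro z u hzu k hk i hi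
    have h1 := hzu k hk i hi
    have h2 : ∀ j, subtree (clampArray (S.piecewise u z)) L k i j
        = subtree (clampArray z) L k i j := by
      intro j
      refine clampArray_piecewise_of_notMem u z fun l hl h => ?_
      rw [hS, Set.mem_ofPred_eq, h] at hl
      have := (Finset.mem_Icc.1 hi).1
      simp only at hl
      omega
    rwa [h2, h2] at h1
  have hθ2 : θ ≤ 1 / 2 := by
    have h4 : (1:ℝ) ≤ 4 ^ p := one_le_pow₀ (by norm_num)
    have h5 : θ ≤ Real.exp (-1) := Real.exp_le_exp.2 (by linarith)
    have := Real.exp_neg_one_lt_half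
    linarith
  have h1 : arrayLaw (A ∩ G) ≤ ENNReal.ofReal (2 * Real.exp (-2 * 4 ^ p)) := by
    conv_lhs => rw [← hmp]
    rw [Measure.map_apply hpw (hAm.inter hGm), Measure.prod_apply (hpw (hAm.inter hGm))]
    calc _ ≤ ∫⁻ _, ENNReal.ofReal (2 * Real.exp (-2 * 4 ^ p)) ∂arrayLaw := by
          refine lintegral_mono fun z => ?_
          by_cases hz : z ∈ G
          · have := arrayLaw_blockIntegral_piecewise_le hh hh1 hm hn S hS hz
            rw [← ENNReal.ofReal_toReal (measure_ne_top arrayLaw _)]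
            refine ENNReal.ofReal_le_ofReal (le_trans ?_ this)
            exact measureReal_mono fun u hu => hu.1
          · refine le_of_eq_of_le ?_ zero_le
            refine measure_mono_null (t := ∅) (fun u hu => hz (hinv z u hu.2)) measure_empty
      _ = _ := by simp
  have h2 := arrayLaw_not_endsWide_le (Real.exp_pos _).le hθ2 L (2 ^ (4 * p + 1)) (2 ^ (4 * p + 2)) p
  calc arrayLaw A ≤ arrayLaw ((A ∩ G) ∪ Gᶜ) := measure_mono fun z hz => by
        by_cases hzG : z ∈ G
        · exact Or.inl ⟨hz, hzG⟩
        · exact Or.inr hzG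
    _ ≤ _ := (measure_union_le _ _).trans (add_le_add h1 h2)
    _ ≤ _ := by
      rw [← ENNReal.ofReal_add (by positivity) (by positivity)]
      refine ENNReal.ofReal_le_ofReal ?_
      have e1 : ((2 ^ (4 * p + 2) - 2 ^ (4 * p + 1) : ℕ) : ℝ) = 2 ^ (4 * p + 1) := by
        rw [show 4 * p + 2 = 4 * p + 1 + 1 by ring, pow_succ _ (4 * p + 1),
          show 2 ^ (4 * p + 1) * 2 - 2 ^ (4 * p + 1) = 2 ^ (4 * p + 1) by omega]
        push_cast; rfl
      have e2 : Real.exp (-2 * 4 ^ p) ≤ θ := Real.exp_le_exp.2 (by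
        have : (0:ℝ) < 4 ^ p := by positivity
        linarith)
      have hp2 : (p : ℝ) ≤ 2 ^ p := by exact_mod_cast Nat.lt_two_pow_self.le
      have hθ0 : 0 < θ := Real.exp_pos _
      have h5 : (1:ℝ) ≤ 2 ^ (5 * p) := one_le_pow₀ (by norm_num)
      rw [e1]
      have e3 : (2:ℝ) ^ (4 * p + 1) * (p * (2 * θ)) ≤ 4 * 2 ^ (5 * p) * θ := by
        calc (2:ℝ) ^ (4 * p + 1) * (p * (2 * θ)) ≤ (2:ℝ) ^ (4 * p + 1) * (2 ^ p * (2 * θ)) := by gcongr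
          _ = 4 * 2 ^ (5 * p) * θ := by ring
      have e4 : (2:ℝ) ^ (5 * p + 3) * θ = 8 * 2 ^ (5 * p) * θ := by rw [pow_add]; ring
      rw [e4]
      nlinarith

end Block

/-! ### The exceptional events -/

/-- A discrete version of `log log M`, with `4 log M ≤ 2 ^ (logLogScale M)`. Among the blocks
`[2 ^ (-m-1), 2 ^ (-m)]` those with `M - m < 8 * logLogScale M` are bounded trivially, for
frequencies of order `2 ^ M`. -/
def logLogScale (M : ℕ) : ℕ := Nat.log 2 (Nat.log 2 M + 1) + 3

lemma four_mul_log_lt_two_pow_logLogScale (M : ℕ) : 4 * (Nat.log 2 M + 1) < 2 ^ logLogScale M := by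
  have h := Nat.lt_pow_succ_log_self (b := 2) one_lt_two (Nat.log 2 M + 1)
  rw [logLogScale, pow_add]
  rw [pow_succ] at h
  omega

lemma lt_two_pow_two_pow_logLogScale (M : ℕ) : M < 2 ^ 2 ^ logLogScale M := by
  have h := Nat.lt_pow_succ_log_self (b := 2) one_lt_two M
  refine h.trans_le (Nat.pow_le_pow_right two_pos ?_)
  have := four_mul_log_lt_two_pow_logLogScale M
  omega

lemma tendsto_logLogScale : Tendsto logLogScale atTop atTop := by
  rw [tendsto_atTop]
  intro b
  filter_upwards [eventually_ge_atTop (2 ^ 2 ^ b)] with M hM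
  by_contra! h
  have h1 := lt_two_pow_two_pow_logLogScale M
  have h2 : 2 ^ 2 ^ logLogScale M ≤ 2 ^ 2 ^ b :=
    Nat.pow_le_pow_right two_pos (Nat.pow_le_pow_right two_pos h.le)
  omega

lemma exp_neg_two_pow_logLogScale_le {M : ℕ} (hM : 1 ≤ M) :
    Real.exp (-2 ^ logLogScale M) ≤ 1 / (M:ℝ) ^ 4 := by
  set y := Nat.log 2 M + 1 with hy
  have h1 : (4 * (y:ℝ)) ≤ 2 ^ logLogScale M := by
    exact_mod_cast (four_mul_log_lt_two_pow_logLogScale M).le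
  have h2 : (M:ℝ) ≤ 2 ^ y := by
    exact_mod_cast (Nat.lt_pow_succ_log_self (b := 2) one_lt_two M).le
  have h3 : (M:ℝ) ≤ Real.exp y := by
    refine h2.trans ?_
    rw [← Real.exp_one_pow]
    exact pow_le_pow_left₀ (by norm_num) (by linarith [Real.exp_one_gt_d9]) y
  have hM0 : (0:ℝ) < M := by exact_mod_cast hM
  calc Real.exp (-2 ^ logLogScale M) ≤ Real.exp (-(4 * y)) := Real.exp_le_exp.2 (by linarith)
    _ = 1 / Real.exp y ^ 4 := by rw [Real.exp_neg, ← Real.exp_nat_mul, one_div]; norm_num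
    _ ≤ 1 / (M:ℝ) ^ 4 := one_div_le_one_div_of_le (by positivity) (by gcongr)

/-- The doubly exponential decay beats the number of frequencies. -/
lemma two_pow_mul_exp_neg_four_pow_le (p : ℕ) :
    (2:ℝ) ^ (21 * p) * Real.exp (-4 ^ p)
      ≤ (Nat.factorial 21 * Real.exp 1) * Real.exp (-2 ^ p) := by
  set u : ℝ := 2 ^ p with hu
  have hu0 : 0 ≤ u := by positivity
  have e1 : (2:ℝ) ^ (21 * p) = u ^ 21 := by rw [hu, ← pow_mul, mul_comm]
  have e2 : (4:ℝ) ^ p = u ^ 2 := by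
    rw [hu, ← pow_mul, mul_comm, pow_mul]; norm_num
  have h1 := Real.pow_div_factorial_le_exp u hu0 21
  rw [div_le_iff₀ (by positivity)] at h1
  rw [e1, e2]
  calc u ^ 21 * Real.exp (-u ^ 2) ≤ (Real.exp u * Nat.factorial 21) * Real.exp (-u ^ 2) := by gcongr
    _ = Nat.factorial 21 * Real.exp (u - u ^ 2) := by
        rw [show u - u ^ 2 = u + -u ^ 2 by ring, Real.exp_add]; ring
    _ ≤ Nat.factorial 21 * Real.exp (1 + -u) := by
        gcongr; nlinarith [sq_nonneg (u - 1)]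
    _ = _ := by rw [Real.exp_add]; ring

/-- The event that for some frequency of the form `2 ^ (M - 2 j) * l`, at least `2 ^ M`, the
integral over a block `[2 ^ (-m-1), 2 ^ (-m)]`, `m = M - j`, is large. -/
def badEvent (h : ℝ → ℝ) (M : ℕ) : Set (OddIndex → ℝ) :=
  ⋃ j ∈ Finset.Ico (8 * logLogScale M) M,
    ⋃ l ∈ (Finset.range (2 ^ (2 * j + 1))).filter (fun l => 2 ^ M ≤ 2 ^ (M - j - j) * l),
      {z | 6 * (1 / 2) ^ (j / 8) < |blockIntegral h (2 ^ (M - j - j) * l) (M - j) (clampArray z)|}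

lemma arrayLaw_badEvent_le {h : ℝ → ℝ} (hh : Measurable h) (hh1 : ∀ y, |h y| ≤ 1) (M : ℕ) :
    arrayLaw (badEvent h M)
      ≤ ENNReal.ofReal ((2 ^ 18 * (Nat.factorial 21 * Real.exp 1)) * (1 / (M:ℝ) ^ 2)) := by
  rcases Nat.eq_zero_or_pos M with rfl | hM
  · simp [badEvent]
  have hM0 : (1:ℝ) ≤ M := by exact_mod_cast hM
  set C : ℝ := 2 ^ 18 * (Nat.factorial 21 * Real.exp 1) with hC
  have hC0 : 0 < C := by positivity
  have hj : ∀ j ∈ Finset.Ico (8 * logLogScale M) M, arrayLaw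
      (⋃ l ∈ (Finset.range (2 ^ (2 * j + 1))).filter (fun l => 2 ^ M ≤ 2 ^ (M - j - j) * l),
      {z | 6 * (1 / 2) ^ (j / 8) < |blockIntegral h (2 ^ (M - j - j) * l) (M - j) (clampArray z)|})
      ≤ ENNReal.ofReal (C * (1 / (M:ℝ) ^ 4)) := by
    intro j hj
    rw [Finset.mem_Ico] at hj
    set p := j / 8 with hp
    have hpM : logLogScale M ≤ p := by omega
    have hp3 : 3 ≤ logLogScale M := by unfold logLogScale; omega
    refine (measure_biUnion_finset_le _ _).trans ?_
    refine (Finset.sum_le_sum fun l hl => arrayLaw_blockIntegral_le hh hh1 (m := M - j) (p := p)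
      (by omega) (by omega) ((Nat.pow_le_pow_right two_pos (by omega)).trans
        (Finset.mem_filter.1 hl).2)).trans ?_
    rw [Finset.sum_const, ← ENNReal.ofReal_nsmul, nsmul_eq_mul]
    refine ENNReal.ofReal_le_ofReal ?_
    have hcard : ((((Finset.range (2 ^ (2 * j + 1))).filter
        (fun l => 2 ^ M ≤ 2 ^ (M - j - j) * l)).card : ℕ) : ℝ) ≤ 2 ^ (16 * p + 15) := by
      have h1 := Finset.card_filter_le (Finset.range (2 ^ (2 * j + 1)))
        (fun l => 2 ^ M ≤ 2 ^ (M - j - j) * l)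
      rw [Finset.card_range] at h1
      have h2 : 2 ^ (2 * j + 1) ≤ 2 ^ (16 * p + 15) := Nat.pow_le_pow_right two_pos (by omega)
      exact_mod_cast h1.trans h2
    calc _ ≤ (2:ℝ) ^ (16 * p + 15) * (2 ^ (5 * p + 3) * Real.exp (-4 ^ p)) := by gcongr
      _ = 2 ^ 18 * (2 ^ (21 * p) * Real.exp (-4 ^ p)) := by ring
      _ ≤ 2 ^ 18 * ((Nat.factorial 21 * Real.exp 1) * Real.exp (-2 ^ p)) := by
          exact mul_le_mul_of_nonneg_left (two_pow_mul_exp_neg_four_pow_le p) (by positivity)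
      _ ≤ 2 ^ 18 * ((Nat.factorial 21 * Real.exp 1) * Real.exp (-2 ^ logLogScale M)) := by
          gcongr; norm_num
      _ ≤ 2 ^ 18 * ((Nat.factorial 21 * Real.exp 1) * (1 / (M:ℝ) ^ 4)) := by
          gcongr; exact exp_neg_two_pow_logLogScale_le hM
      _ = _ := by rw [hC]; ring
  refine (measure_biUnion_finset_le _ _).trans ((Finset.sum_le_sum hj).trans ?_)
  rw [Finset.sum_const, ← ENNReal.ofReal_nsmul, nsmul_eq_mul]
  refine ENNReal.ofReal_le_ofReal ?_
  have hcard : (((Finset.Ico (8 * logLogScale M) M).card : ℕ) : ℝ) ≤ M := by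
    rw [Nat.card_Ico]; exact_mod_cast Nat.sub_le _ _
  calc _ ≤ (M:ℝ) * (C * (1 / (M:ℝ) ^ 4)) := by gcongr
    _ = C * (1 / (M:ℝ) ^ 3) := by field_simp
    _ ≤ C * (1 / (M:ℝ) ^ 2) := by gcongr; norm_num

/-- Rounding the frequency on a block changes the integral only slightly. -/
lemma abs_blockIntegral_sub_le {h : ℝ → ℝ} (hh : Measurable h) (hh1 : ∀ y, |h y| ≤ 1)
    {x : ℕ → ℕ → ℝ} (hx : ∀ n k, x n k ∈ Set.Icc (0:ℝ) 1) {n' n : ℕ} (hn : n' ≤ n) (m : ℕ) :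
    |blockIntegral h n m x - blockIntegral h n' m x| ≤ ((n : ℝ) - n') / 2 ^ m := by
  have hi := fun n => intervalIntegrable_dyadicMap_comp hh hh1 (continuous_dirichletKer n) hx
    (1 / 2 ^ (m + 1)) (1 / 2 ^ m)
  unfold blockIntegral
  rw [← intervalIntegral.integral_sub (hi n) (hi n'), ← Real.norm_eq_abs]
  refine (intervalIntegral.norm_integral_le_of_norm_le_const (C := 2 * ((n:ℝ) - n'))
    fun t _ => ?_).trans (le_of_eq ?_)
  · rw [← mul_sub, norm_mul]
    exact (mul_le_of_le_one_left (norm_nonneg _) (hh1 _)).trans (abs_dirichletKer_sub_le hn t)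
  · rw [pow_succ, abs_of_nonneg]
    · field_simp; norm_num
    · rw [sub_nonneg]; gcongr; linarith [pow_pos (two_pos (α := ℝ)) m]

lemma ae_eventually_abs_blockIntegral_le {h : ℝ → ℝ} (hh : Measurable h) (hh1 : ∀ y, |h y| ≤ 1) :
    ∀ᵐ z ∂arrayLaw, ∀ᶠ M in atTop, ∀ j ∈ Finset.Ico (8 * logLogScale M) M,
      ∀ n ∈ Finset.Ico (2 ^ M) (2 ^ (M + 1)),
        |blockIntegral h n (M - j) (clampArray z)| ≤ 6 * (1 / 2) ^ (j / 8) + (1 / 2) ^ j := by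
  have hsum : ∑' M, arrayLaw (badEvent h M) ≠ ⊤ := by
    refine ne_top_of_le_ne_top ?_ (ENNReal.tsum_le_tsum (arrayLaw_badEvent_le hh hh1))
    rw [← ENNReal.ofReal_tsum_of_nonneg (fun n => by positivity)
      ((Real.summable_one_div_nat_pow.2 one_lt_two).mul_left _)]
    exact ENNReal.ofReal_ne_top
  filter_upwards [ae_eventually_notMem hsum] with z hz
  filter_upwards [hz] with M hM j hj n hn
  simp only [badEvent, Set.mem_iUnion, not_exists, Finset.mem_filter, Finset.mem_range,
    Set.mem_ofPred_eq, not_lt, and_imp] at hM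
  rw [Finset.mem_Ico] at hn
  have hjM := (Finset.mem_Ico.1 hj).2
  set d := 2 ^ (M - j - j) with hd
  have hd0 : 0 < d := by positivity
  have hl : n / d < 2 ^ (2 * j + 1) := by
    refine Nat.div_lt_of_lt_mul (hn.2.trans_le ?_)
    rw [hd, ← pow_add]
    exact Nat.pow_le_pow_right two_pos (by omega)
  have hge : 2 ^ M ≤ d * (n / d) := by
    obtain ⟨e, he⟩ : d ∣ 2 ^ M := pow_dvd_pow 2 (by omega)
    rw [he]
    refine Nat.mul_le_mul_left d ((Nat.le_div_iff_mul_le hd0).2 ?_)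
    rw [mul_comm, ← he]; exact hn.1
  have h1 := hM j hj (n / d) hl hge
  have h2 := abs_blockIntegral_sub_le hh hh1 (clampArray_mem z) (Nat.mul_div_le n d) (M - j)
  have h3 : ((n:ℝ) - ((d * (n / d) : ℕ) : ℝ)) / 2 ^ (M - j) ≤ (1 / 2) ^ j := by
    have h4 : n - d * (n / d) ≤ d - 1 := by
      have := Nat.mod_lt n hd0
      have := Nat.div_add_mod n d
      omega
    have h5 : (n:ℝ) - ((d * (n / d) : ℕ) : ℝ) ≤ d - 1 := by
      rw [← Nat.cast_sub (Nat.mul_div_le n d)]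
      have : ((n - d * (n / d) : ℕ) : ℝ) ≤ ((d - 1 : ℕ) : ℝ) := by exact_mod_cast h4
      rwa [Nat.cast_sub hd0, Nat.cast_one] at this
    rw [div_le_iff₀ (by positivity)]
    refine h5.trans ?_
    rcases le_total j (M - j) with hle | hle
    · obtain ⟨e, he⟩ := Nat.exists_eq_add_of_le hle
      have hde : (d:ℝ) = 2 ^ e := by rw [hd, he]; simp
      rw [hde, he, pow_add, ← mul_assoc, ← mul_pow]; norm_num
    · have hde : (d:ℝ) = 1 := by rw [hd, Nat.sub_eq_zero_of_le hle]; simp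
      rw [hde, sub_self]; positivity
  have h6 := abs_sub_abs_le_abs_sub (blockIntegral h n (M - j) (clampArray z))
    (blockIntegral h (d * (n / d)) (M - j) (clampArray z))
  linarith

/-! ### Convergence of the integral over the right half-neighbourhood of `0` -/

lemma eventually_logLogScale_le_log_log :
    ∀ᶠ M : ℕ in atTop, (logLogScale M : ℝ) ≤ 7 * Real.log (Real.log M) := by
  have t1 : Tendsto (fun M : ℕ => Real.log M) atTop atTop :=
    Real.tendsto_log_atTop.comp tendsto_natCast_atTop_atTop
  have t2 : Tendsto (fun M : ℕ => Real.log (Real.log M)) atTop atTop :=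
    Real.tendsto_log_atTop.comp t1
  have hl2 : (1:ℝ) / 2 < Real.log 2 := by linarith [Real.log_two_gt_d9]
  filter_upwards [t1.eventually_ge_atTop 1, t2.eventually_ge_atTop 2, eventually_ge_atTop 1]
    with M h1 h2 hM
  have hM0 : (0:ℝ) < M := by exact_mod_cast hM
  have natlog : ∀ k : ℕ, 1 ≤ k → (Nat.log 2 k : ℝ) ≤ 2 * Real.log k := by
    intro k hk
    have h3 : ((2 ^ Nat.log 2 k : ℕ) : ℝ) ≤ k := by exact_mod_cast Nat.pow_log_le_self 2 (by omega)
    have h4 := Real.log_le_log (by positivity) h3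
    push_cast at h4
    rw [Real.log_pow] at h4
    nlinarith [Nat.cast_nonneg (α := ℝ) (Nat.log 2 k)]
  have h3 := natlog M hM
  have h4 := natlog (Nat.log 2 M + 1) (by omega)
  have h5 : Real.log ((Nat.log 2 M + 1 : ℕ) : ℝ) ≤ 2 * Real.log (Real.log M) := by
    have h6 : ((Nat.log 2 M + 1 : ℕ) : ℝ) ≤ 3 * Real.log M := by push_cast; linarith
    have h7 := Real.log_le_log (by positivity) h6
    rw [Real.log_mul (by norm_num) (by linarith)] at h7
    have h8 : Real.log 3 ≤ 2 := (Real.log_le_sub_one_of_pos (by norm_num)).trans (by norm_num)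
    linarith
  have h6 : (logLogScale M : ℝ) = Nat.log 2 (Nat.log 2 M + 1) + 3 := by
    simp [logLogScale]
  rw [h6]
  linarith

lemma eventually_sixteen_mul_logLogScale_le : ∀ᶠ M : ℕ in atTop, 16 * logLogScale M ≤ M := by
  have h := (Real.isLittleO_log_id_atTop.comp_tendsto
    (tendsto_natCast_atTop_atTop (R := ℝ))).bound (show (0:ℝ) < 1 / 112 by norm_num)
  filter_upwards [eventually_logLogScale_le_log_log, h, eventually_ge_atTop 1] with M h1 h2 h3
  simp only [Function.comp, Real.norm_eq_abs, id, Nat.abs_cast] at h2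
  have h4 : Real.log (Real.log M) ≤ Real.log M :=
    Real.log_le_self (Real.log_nonneg (by exact_mod_cast h3))
  have h5 : ((16 * logLogScale M : ℕ) : ℝ) ≤ M := by
    push_cast; linarith [le_abs_self (Real.log M)]
  exact_mod_cast h5

/-- The number of blocks to be bounded trivially is at most a constant times the triple logarithm of
`1 / δ`, where `δ = (9 / 10) ^ (M - 8 * logLogScale M)` bounds `φ` on these blocks. -/
lemma eventually_logLogScale_le_log_log_log :
    ∀ᶠ M : ℕ in atTop, 8 * logLogScale M ≤ M ∧
      0 < Real.log (Real.log (Real.log (1 / (9 / 10) ^ (M - 8 * logLogScale M)))) ∧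
      (8 * logLogScale M + 4 : ℝ)
        ≤ 122 * Real.log (Real.log (Real.log (1 / (9 / 10) ^ (M - 8 * logLogScale M)))) := by
  have t1 : Tendsto (fun M : ℕ => Real.log M) atTop atTop :=
    Real.tendsto_log_atTop.comp tendsto_natCast_atTop_atTop
  have t2 : Tendsto (fun M : ℕ => Real.log (Real.log M)) atTop atTop :=
    Real.tendsto_log_atTop.comp t1
  set c : ℝ := Real.log (10 / 9) with hc
  have hc0 : 0 < c := Real.log_pos (by norm_num)
  filter_upwards [eventually_logLogScale_le_log_log, t1.eventually_ge_atTop 1,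
    t1.eventually_ge_atTop (-2 * Real.log (c / 2)), t2.eventually_ge_atTop 2,
    eventually_sixteen_mul_logLogScale_le, eventually_ge_atTop 1] with M h1 h2 h3 h4 h5 hM
  have hM0 : (0:ℝ) < M := by exact_mod_cast hM
  set T := Real.log (Real.log M) with hT
  have hJ : (8 * logLogScale M : ℝ) ≤ M / 2 := by
    have : ((16 * logLogScale M : ℕ) : ℝ) ≤ M := by exact_mod_cast h5
    push_cast at this; linarith
  have hJ' : 8 * logLogScale M ≤ M := by omega
  have e1 : Real.log (1 / (9 / 10) ^ (M - 8 * logLogScale M)) = (M - 8 * logLogScale M) * c := by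
    rw [← one_div_pow, Real.log_pow, Nat.cast_sub hJ', hc]; norm_num
  have h6 : c / 2 * M ≤ (M - 8 * logLogScale M) * c := by nlinarith
  have h7 : 1 / 2 * Real.log M ≤ Real.log ((M - 8 * logLogScale M) * c) := by
    have := Real.log_le_log (by positivity) h6
    rw [Real.log_mul (by positivity) hM0.ne'] at this
    linarith
  have h8 : T / 2 ≤ Real.log (Real.log ((M - 8 * logLogScale M) * c)) := by
    have := Real.log_le_log (by linarith) h7
    rw [Real.log_mul (by norm_num) (by linarith), one_div, Real.log_inv] at this
    have : Real.log 2 < 1 := by linarith [Real.log_two_lt_d9]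
    linarith
  rw [e1]
  exact ⟨hJ', by linarith, by linarith⟩

lemma summable_half_pow_div_eight :
    Summable fun j : ℕ => 6 * (1 / 2 : ℝ) ^ (j / 8) + (1 / 2) ^ j := by
  refine (Summable.mul_left 6 ?_).add (summable_geometric_of_lt_one (by norm_num) (by norm_num))
  set κ : ℝ := (1 / 2) ^ ((1:ℝ) / 8) with hκ
  have hκ0 : 0 < κ := by positivity
  have hκ1 : κ < 1 := Real.rpow_lt_one (by norm_num) (by norm_num) (by norm_num)
  have hκ8 : κ ^ 8 = 1 / 2 := by
    rw [hκ, ← Real.rpow_natCast, ← Real.rpow_mul (by norm_num)]; norm_num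
  refine Summable.of_nonneg_of_le (fun j => by positivity) (fun j => ?_)
    ((summable_geometric_of_lt_one hκ0.le hκ1).mul_left 2)
  rw [← hκ8, ← pow_mul]
  have h1 : κ ^ (8 * (j / 8)) * κ ^ 8 ≤ κ ^ j := by
    rw [← pow_add]
    exact pow_le_pow_of_le_one hκ0.le hκ1.le (by omega)
  rw [hκ8] at h1
  linarith

section OneSided

variable {h : ℝ → ℝ} {x : ℕ → ℕ → ℝ}

lemma integral_zero_half_eq (hh : Measurable h) (hh1 : ∀ y, |h y| ≤ 1)
    (hx : ∀ n k, x n k ∈ Set.Icc (0:ℝ) 1) (n : ℕ) {M : ℕ} (hM : 1 ≤ M) :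
    ∫ t in (0:ℝ)..1 / 2, h (dyadicMap x t) * dirichletKer n t =
      (∫ t in (0:ℝ)..1 / 2 ^ M, h (dyadicMap x t) * dirichletKer n t) +
        ∑ j ∈ Finset.Ico 1 M, blockIntegral h n (M - j) x := by
  have hi := intervalIntegrable_dyadicMap_comp hh hh1 (continuous_dirichletKer n) hx
  have h1 := intervalIntegral.sum_integral_adjacent_intervals_Ico (μ := volume)
    (f := fun t => h (dyadicMap x t) * dirichletKer n t) (a := fun m : ℕ => (1:ℝ) / 2 ^ m) hM
    (fun k _ => hi _ _)
  have h2 : ∑ j ∈ Finset.Ico 1 M, blockIntegral h n (M - j) x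
      = ∑ m ∈ Finset.Ico 1 M, blockIntegral h n m x := by
    have := Finset.sum_Ico_reflect (fun m => blockIntegral h n m x) 1 (Nat.le_succ M)
    simpa using this
  have h3 : ∑ m ∈ Finset.Ico 1 M, blockIntegral h n m x
      = ∫ t in (1:ℝ) / 2 ^ M..1 / 2 ^ 1, h (dyadicMap x t) * dirichletKer n t := by
    rw [intervalIntegral.integral_symm, ← h1, ← Finset.sum_neg_distrib]
    refine Finset.sum_congr rfl fun m _ => ?_
    rw [blockIntegral, intervalIntegral.integral_symm]
  rw [h2, h3, pow_one, intervalIntegral.integral_add_adjacent_intervals (hi _ _) (hi _ _)]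

/-- Convergence to `0` of the integral against the Dirichlet kernel, for an array with exponentially
small gaps which avoids the exceptional events. -/
lemma tendsto_integral_zero_half (hh : Measurable h) (hh1 : ∀ y, |h y| ≤ 1)
    (hx : ∀ n k, x n k ∈ Set.Icc (0:ℝ) 1) (h0 : h 0 = 0)
    (hlog : h =o[𝓝[>] (0:ℝ)] fun y => (Real.log (Real.log (Real.log (1 / y))))⁻¹)
    (hgap : ∀ᶠ n in atTop, ∀ k < 2 ^ n, gap x n k < (9 / 10) ^ n)
    (hblock : ∀ᶠ M in atTop, ∀ j ∈ Finset.Ico (8 * logLogScale M) M,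
      ∀ n ∈ Finset.Ico (2 ^ M) (2 ^ (M + 1)),
        |blockIntegral h n (M - j) x| ≤ 6 * (1 / 2) ^ (j / 8) + (1 / 2) ^ j) :
    Tendsto (fun n : ℕ => ∫ t in (0:ℝ)..1 / 2, h (dyadicMap x t) * dirichletKer n t)
      atTop (𝓝 0) := by
  set J : ℕ → ℕ := fun M => 8 * logLogScale M with hJ
  set g : ℕ → ℝ := fun j => 6 * (1 / 2 : ℝ) ^ (j / 8) + (1 / 2) ^ j with hg
  have hg0 : ∀ j, 0 ≤ g j := fun j => by simp only [hg]; positivity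
  have hgs : Summable g := summable_half_pow_div_eight
  set Lg : ℕ → ℝ := fun M =>
    Real.log (Real.log (Real.log (1 / (9 / 10) ^ (M - J M)))) with hLg
  have hJt : Tendsto J atTop atTop :=
    tendsto_atTop_mono (fun M => by simp only [hJ]; omega) tendsto_logLogScale
  have hMJ : Tendsto (fun M => M - J M) atTop atTop := by
    rw [tendsto_atTop]
    intro b
    filter_upwards [eventually_sixteen_mul_logLogScale_le, eventually_ge_atTop (2 * b)] with M h1 h2
    simp only [hJ]
    omega
  have main : ∀ ε : ℝ, 0 < ε → ∀ᶠ M in atTop, ∀ n ∈ Finset.Ico (2 ^ M) (2 ^ (M + 1)),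
      |∫ t in (0:ℝ)..1 / 2, h (dyadicMap x t) * dirichletKer n t| ≤ 122 * ε + ε := by
    intro ε hε
    -- the size of `h` near `0`
    obtain ⟨r, hr0, hr⟩ : ∃ r > 0, ∀ y, 0 < y → y < r →
        |h y| ≤ ε * |(Real.log (Real.log (Real.log (1 / y))))⁻¹| := by
      have := hlog.bound hε
      rw [eventually_nhdsWithin_iff, Metric.eventually_nhds_iff] at this
      obtain ⟨r, hr0, hr⟩ := this
      refine ⟨r, hr0, fun y hy0 hyr => ?_⟩
      simpa using hr (by simpa [abs_of_pos hy0] using hyr) hy0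
    have hpow : Tendsto (fun M => ((9:ℝ) / 10) ^ (M - J M)) atTop (𝓝 0) :=
      (tendsto_pow_atTop_nhds_zero_of_lt_one (by norm_num) (by norm_num)).comp hMJ
    have htail : ∀ᶠ M in atTop, ∑' i, g (i + J M) < ε :=
      ((tendsto_sum_nat_add g).comp hJt).eventually_lt_const hε
    filter_upwards [hblock, hMJ.eventually hgap, eventually_logLogScale_le_log_log_log,
      hpow.eventually_lt_const hr0, hpow.eventually_lt_const (Real.exp_pos (-Real.exp 1)),
      htail, eventually_ge_atTop 1] with M hb hgM hL hpr hpe ht hM1 n hn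
    obtain ⟨hJM, hLpos, hJL⟩ := hL
    change 0 < Lg M at hLpos
    set η : ℝ := ε * (Lg M)⁻¹ with hη
    have hη0 : 0 ≤ η := by positivity
    set ρ : ℝ := (9 / 10) ^ (M - J M) with hρ
    have hρ0 : 0 < ρ := by positivity
    have hsmall : ∀ y, 0 ≤ y → y ≤ ρ → |h y| ≤ η := by
      intro y hy0 hyρ
      rcases eq_or_lt_of_le hy0 with rfl | hy
      · simpa [h0] using hη0
      have h1 : Real.exp (Real.exp 1) < 1 / ρ := by
        rw [lt_div_iff₀ hρ0, ← lt_div_iff₀' (Real.exp_pos _), ← Real.exp_zero, ← Real.exp_sub]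
        simpa using hpe
      have h2 : Real.exp 1 < Real.log (1 / ρ) := by
        rw [Real.lt_log_iff_exp_lt (by positivity)]; exact h1
      have h3 : 1 < Real.log (Real.log (1 / ρ)) := by
        rw [Real.lt_log_iff_exp_lt ((Real.exp_pos _).trans h2)]; exact h2
      have h4 : Real.log (1 / ρ) ≤ Real.log (1 / y) :=
        Real.log_le_log (by positivity) (one_div_le_one_div_of_le hy hyρ)
      have h5 : Real.log (Real.log (1 / ρ)) ≤ Real.log (Real.log (1 / y)) :=
        Real.log_le_log ((Real.exp_pos _).trans h2) h4
      have h6 : Lg M ≤ Real.log (Real.log (Real.log (1 / y))) :=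
        Real.log_le_log (by linarith) h5
      refine (hr y hy (hyρ.trans_lt hpr)).trans ?_
      rw [abs_of_nonneg (inv_nonneg.2 (hLpos.le.trans h6))]
      exact mul_le_mul_of_nonneg_left (inv_anti₀ hLpos h6) hε.le
    have hφ : ∀ t, t ≤ 1 / 2 ^ (M - J M) → |h (dyadicMap x t)| ≤ η := by
      intro t ht
      refine hsmall _ (dyadicMap_nonneg hx t) ?_
      have h1 := hgM 0 (by positivity)
      simp only [gap, zero_add, dyadicValue_zero_right, sub_zero] at h1
      exact (dyadicMap_le_dyadicValue hx (n := M - J M) (k := 1) (by simpa using ht)).trans h1.le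
    rw [Finset.mem_Ico] at hn
    have hle : ∀ {a b : ℕ}, a ≤ b → (1:ℝ) / 2 ^ b ≤ 1 / 2 ^ a := fun {a b} hab =>
      one_div_le_one_div_of_le (by positivity) (pow_le_pow_right₀ one_le_two hab)
    -- the neighbourhood of `0` on which the kernel does not oscillate
    have hfirst : |∫ t in (0:ℝ)..1 / 2 ^ M, h (dyadicMap x t) * dirichletKer n t| ≤ 4 * η := by
      have h2M : (0:ℝ) < 2 ^ M := by positivity
      have hn' : (2 * n + 1 : ℝ) ≤ 4 * 2 ^ M := by
        have : 2 * n + 1 ≤ 4 * 2 ^ M := by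
          have := hn.2
          rw [pow_succ] at this
          omega
        exact_mod_cast this
      rw [← Real.norm_eq_abs]
      refine (intervalIntegral.norm_integral_le_of_norm_le_const (C := η * (4 * 2 ^ M))
        fun t ht => ?_).trans (le_of_eq ?_)
      · rw [Set.uIoc_of_le (by positivity)] at ht
        rw [norm_mul]
        exact mul_le_mul (hφ t (ht.2.trans (hle (Nat.sub_le _ _))))
          ((abs_dirichletKer_le n t).trans hn') (norm_nonneg _) hη0
      · rw [sub_zero, abs_of_pos (by positivity)]; field_simp
    have hblk : ∀ j ∈ Finset.Ico 1 M, |blockIntegral h n (M - j) x|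
        ≤ if j < J M then η else g j := by
      intro j hj
      rw [Finset.mem_Ico] at hj
      split_ifs with hjJ
      · set m := M - j with hm
        have hmM : M - J M + 1 ≤ m := by simp only [hJ] at hjJ hJM ⊢; omega
        have hlt : (1:ℝ) / 2 ^ (m + 1) ≤ 1 / 2 ^ m := hle (Nat.le_succ m)
        rw [blockIntegral, ← Real.norm_eq_abs]
        refine (intervalIntegral.norm_integral_le_of_norm_le_const (C := η * 2 ^ m)
          fun t ht => ?_).trans ?_
        · rw [Set.uIoc_of_le hlt] at ht
          have hp : (0:ℝ) < 1 / 2 ^ (m + 1) := by positivity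
          rw [norm_mul]
          refine mul_le_mul (hφ t (ht.2.trans (hle (by omega)))) ?_ (norm_nonneg _) hη0
          refine (abs_dirichletKer_le_inv n (hp.trans ht.1) (ht.2.trans ?_)).trans ?_
          · exact (hle (by omega : 1 ≤ m)).trans (by norm_num)
          · calc (2 * t)⁻¹ ≤ (2 * (1 / 2 ^ (m + 1)))⁻¹ := by gcongr; exact ht.1.le
              _ = 2 ^ m := by rw [pow_succ]; field_simp
        · have e : η * 2 ^ m * |1 / 2 ^ m - 1 / 2 ^ (m + 1)| = η / 2 := by
            rw [abs_of_nonneg (sub_nonneg.2 hlt), pow_succ]; field_simp; norm_num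
          rw [e]; linarith
      · exact hb j (Finset.mem_Ico.2 ⟨not_lt.1 hjJ, hj.2⟩) n (Finset.mem_Ico.2 hn)
    have hsum : ∑ j ∈ Finset.Ico 1 M, |blockIntegral h n (M - j) x| ≤ J M * η + ε := by
      refine (Finset.sum_le_sum hblk).trans ?_
      have hsub : Finset.Ico 1 M ⊆ Finset.range M := by
        intro j hj; simp only [Finset.mem_Ico, Finset.mem_range] at hj ⊢; exact hj.2
      refine (Finset.sum_le_sum_of_subset_of_nonneg hsub fun j _ _ => ?_).trans ?_
      · split_ifs
        · exact hη0
        · exact hg0 j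
      rw [← Finset.sum_range_add_sum_Ico _ hJM]
      refine add_le_add ?_ ?_
      · rw [Finset.sum_congr rfl (g := fun _ => η)
          fun j hj => if_pos (Finset.mem_range.1 hj)]
        simp [hJ]
      · rw [Finset.sum_congr rfl (g := g)
          fun j hj => if_neg (not_lt.2 (Finset.mem_Ico.1 hj).1), Finset.sum_Ico_eq_sum_range]
        refine le_trans ?_ ht.le
        have hs : Summable fun i => g (i + J M) := (summable_nat_add_iff (J M)).2 hgs
        refine le_trans (le_of_eq ?_) (hs.sum_le_tsum (Finset.range (M - 8 * logLogScale M))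
          fun i _ => hg0 _)
        exact Finset.sum_congr rfl fun i _ => by rw [add_comm (8 * logLogScale M) i]
    have hJη : (J M + 4) * η ≤ 122 * ε := by
      have hJL' : ((J M : ℝ) + 4) ≤ 122 * Lg M := by
        simp only [hJ]; push_cast; exact hJL
      calc (J M + 4) * η ≤ (122 * Lg M) * η := by gcongr
        _ = 122 * ε := by rw [hη]; field_simp
    rw [integral_zero_half_eq hh hh1 hx n hM1]
    have h1 := abs_add_le (∫ t in (0:ℝ)..1 / 2 ^ M, h (dyadicMap x t) * dirichletKer n t)
      (∑ j ∈ Finset.Ico 1 M, blockIntegral h n (M - j) x)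
    have h2 := Finset.abs_sum_le_sum_abs (fun j => blockIntegral h n (M - j) x) (Finset.Ico 1 M)
    linarith
  rw [Metric.tendsto_atTop]
  intro ε hε
  obtain ⟨M₀, hM₀⟩ := eventually_atTop.1 (main (ε / 124) (by positivity))
  refine ⟨2 ^ M₀, fun n hn => ?_⟩
  have hn0 : n ≠ 0 := by have := Nat.one_le_two_pow (n := M₀); omega
  have h1 := hM₀ (Nat.log 2 n) ((Nat.le_log_iff_pow_le one_lt_two hn0).2 hn) n
    (Finset.mem_Ico.2 ⟨Nat.pow_log_le_self 2 hn0, Nat.lt_pow_succ_log_self one_lt_two n⟩)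
  rw [Real.dist_eq, sub_zero]
  linarith

end OneSided

/-- The one-sided statement on the canonical probability space. -/
lemma ae_tendsto_integral_zero_half {h : ℝ → ℝ} (hh : Measurable h) (hh1 : ∀ y, |h y| ≤ 1)
    (h0 : h 0 = 0)
    (hlog : h =o[𝓝[>] (0:ℝ)] fun y => (Real.log (Real.log (Real.log (1 / y))))⁻¹) :
    ∀ᵐ z ∂arrayLaw, Tendsto (fun n : ℕ =>
      ∫ t in (0:ℝ)..1 / 2, h (dyadicMap (clampArray z) t) * dirichletKer n t) atTop (𝓝 0) := by
  filter_upwards [ae_eventually_gap_lt, ae_eventually_abs_blockIntegral_le hh hh1] with z h1 h2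
  exact tendsto_integral_zero_half hh hh1 (clampArray_mem z) h0 hlog h1 h2

/-! ### Both sides of `0` -/

/-- The index of the point symmetric to `k / 2 ^ n` with respect to `1 / 2`. -/
def OddIndex.reflect (i : OddIndex) : OddIndex :=
  ⟨(i.1.1, 2 ^ i.1.1 - i.1.2), by
    obtain ⟨⟨n, k⟩, hk, hkn⟩ := i
    simp only at hk hkn ⊢
    have hn : n ≠ 0 := by
      rintro rfl
      have : k = 0 := by simpa using hkn
      simp [this] at hk
    have h2 : Even (2 ^ n) := (Nat.even_pow.2 ⟨even_two, hn⟩)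
    refine ⟨Nat.Even.sub_odd hkn.le h2 hk, ?_⟩
    have := hk.pos
    omega⟩

lemma OddIndex.reflect_injective : Function.Injective OddIndex.reflect := by
  rintro ⟨⟨n, k⟩, hk, hkn⟩ ⟨⟨n', k'⟩, hk', hkn'⟩ h
  simp only [OddIndex.reflect, Subtype.mk.injEq, Prod.mk.injEq] at h
  obtain ⟨rfl, h⟩ := h
  simp only at hkn hkn'
  simp only [Subtype.mk.injEq, Prod.mk.injEq, true_and]
  omega

lemma unifLaw_map_one_sub : unifLaw.map (fun v => 1 - v) = unifLaw := by
  have h := (Measure.measurePreserving_sub_left volume (1:ℝ)).restrict_preimage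
    (measurableSet_Icc (a := (0:ℝ)) (b := 1))
  have h2 : (fun v : ℝ => 1 - v) ⁻¹' Set.Icc 0 1 = Set.Icc 0 1 := by
    ext v; simp only [Set.mem_preimage, Set.mem_Icc]; constructor <;> rintro ⟨h1, h2⟩ <;>
      constructor <;> linarith
  rw [h2] at h
  exact h.map_eq

/-- The canonical law is invariant under reflection. -/
lemma arrayLaw_map_reflect : arrayLaw.map (fun z i => 1 - z (OddIndex.reflect i)) = arrayLaw := by
  have h0 : iIndepFun (fun (i : OddIndex) (u : OddIndex → ℝ) => u i) arrayLaw :=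
    iIndepFun_infinitePi (P := fun _ : OddIndex => unifLaw) (X := fun _ v => v)
      (fun _ => measurable_id)
  have h1 := (h0.precomp OddIndex.reflect_injective).comp (fun _ v => 1 - v) fun _ => by fun_prop
  have h2 := h1.map_fun_eq_infinitePi_map fun i => by
    simp only [Function.comp_def]; fun_prop
  simp only [Function.comp_def] at h2
  rw [h2]
  conv_rhs => rw [arrayLaw]
  congr 1; ext1 i
  have h3 := Measure.map_map (μ := arrayLaw) (g := fun v : ℝ => 1 - v)
    (f := fun z => z (OddIndex.reflect i)) (by fun_prop) (by fun_prop)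
  simp only [Function.comp_def] at h3
  rw [← h3, arrayLaw_map_eval, unifLaw_map_one_sub]

lemma clampArray_reflect (z : OddIndex → ℝ) {n k : ℕ} (hk : Odd k) (hkn : k < 2 ^ n) :
    clampArray (fun i => 1 - z (OddIndex.reflect i)) n k = reflect (clampArray z) n k := by
  have h := (OddIndex.reflect ⟨(n, k), hk, hkn⟩).2
  simp only [OddIndex.reflect] at h
  rw [reflect, clampArray_of_index _ ⟨hk, hkn⟩, clampArray_of_index _ h]
  simp only [OddIndex.reflect]
  set v := z ⟨(n, 2 ^ n - k), h⟩
  rcases le_total v 0 with h1 | h1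
  · rw [min_eq_left (by linarith), max_eq_right zero_le_one, max_eq_left (min_le_of_right_le h1)]
    ring
  · rcases le_total v 1 with h2 | h2
    · rw [min_eq_right (by linarith), max_eq_right (by linarith), min_eq_right h2, max_eq_right h1]
    · rw [max_eq_left (min_le_of_right_le (by linarith)), min_eq_left h2, max_eq_right zero_le_one]
      ring

lemma ae_tendsto_integral_zero_one {h : ℝ → ℝ} (hh : Measurable h) (hh1 : ∀ y, |h y| ≤ 1)
    (h0 : h 0 = 0) (h1 : h 1 = 0)
    (hlog0 : h =o[𝓝[>] (0:ℝ)] fun y => (Real.log (Real.log (Real.log (1 / y))))⁻¹)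
    (hlog1 : (fun y => h (1 - y)) =o[𝓝[>] (0:ℝ)]
      fun y => (Real.log (Real.log (Real.log (1 / y))))⁻¹) :
    ∀ᵐ z ∂arrayLaw, Tendsto (fun n : ℕ =>
      ∫ t in (0:ℝ)..1, h (dyadicMap (clampArray z) t) * dirichletKer n t) atTop (𝓝 0) := by
  have hright := ae_tendsto_integral_zero_half (h := fun y => h (1 - y)) (hh.comp (by fun_prop))
    (fun y => hh1 _) (by simpa using h1) hlog1
  rw [← arrayLaw_map_reflect] at hright
  have hmeas : Measurable fun (z : OddIndex → ℝ) i => 1 - z (OddIndex.reflect i) := by fun_prop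
  have hright' := ae_of_ae_map hmeas.aemeasurable hright
  filter_upwards [ae_tendsto_integral_zero_half hh hh1 h0 hlog0, hright', ae_eventually_gap_lt]
    with z hz1 hz2 hz3
  have hx := clampArray_mem z
  have hi := fun n => intervalIntegrable_dyadicMap_comp hh hh1 (continuous_dirichletKer n) hx
  have hz := hz1.add hz2
  rw [add_zero] at hz
  refine hz.congr fun n => ?_
  have e : ∫ t in (0:ℝ)..1 / 2, h (1 - dyadicMap
        (clampArray fun i => 1 - z (OddIndex.reflect i)) t) * dirichletKer n t
      = ∫ t in (1:ℝ) / 2..1, h (dyadicMap (clampArray z) t) * dirichletKer n t := by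
    have h2 := intervalIntegral.integral_comp_sub_left (a := 0) (b := 1 / 2)
      (fun t => h (dyadicMap (clampArray z) t) * dirichletKer n t) 1
    rw [sub_zero, show (1:ℝ) - 1 / 2 = 1 / 2 by norm_num] at h2
    rw [← h2]
    refine intervalIntegral.integral_congr fun t ht => ?_
    rw [Set.uIcc_of_le (by norm_num)] at ht
    have ht1 : t ∈ Set.Icc (0:ℝ) 1 := ⟨ht.1, ht.2.trans (by norm_num)⟩
    rw [dyadicMap_congr (fun n k hk hkn => clampArray_reflect z hk hkn) ht1.2,
      dyadicMap_reflect hx (gapsVanish_of_eventually_lt hz3) ht1, dirichletKer_one_sub]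
    congr 2; ring
  rw [e, intervalIntegral.integral_add_adjacent_intervals (hi n _ _) (hi n _ _)]

/-! ### Fourier partial sums -/

lemma sum_fourier_neg_eq_dirichletKer (n : ℕ) (t : ℝ) :
    ∑ k ∈ Finset.Icc (-(n : ℤ)) (n : ℤ), fourier (-k) (t : UnitAddCircle) = (dirichletKer n t : ℂ) := by
  induction n with
  | zero => simp [dirichletKer]
  | succ n ih =>
    have hset : Finset.Icc (-((n + 1 : ℕ) : ℤ)) ((n + 1 : ℕ) : ℤ)
        = insert ((n + 1 : ℕ) : ℤ) (insert (-((n + 1 : ℕ) : ℤ)) (Finset.Icc (-(n : ℤ)) (n : ℤ))) := by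
      ext k; simp only [Finset.mem_insert, Finset.mem_Icc]; omega
    rw [hset, Finset.sum_insert (by simp only [Finset.mem_insert, Finset.mem_Icc]; omega),
      Finset.sum_insert (by simp only [Finset.mem_Icc]; omega), ih]
    have h : dirichletKer (n + 1) t
        = dirichletKer n t + 2 * Real.cos (2 * Real.pi * (n + 1) * t) := by
      simp only [dirichletKer, Finset.sum_range_succ]; ring
    rw [h, fourier_coe_apply, fourier_coe_apply]
    push_cast
    rw [Complex.two_cos]
    ring_nf

lemma fourierPartialSum_compHomeo {x : ℕ → ℕ → ℝ} (hx : ∀ n k, x n k ∈ Set.Icc (0:ℝ) 1)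
    (f : C(UnitAddCircle, ℂ)) (φ : unitInterval ≃ₜ unitInterval)
    (hφ : ∀ t : unitInterval, (φ t : ℝ) = dyadicMap x t) (n : ℕ) :
    fourierPartialSum (compHomeo f φ) n 0
      = ∫ t in (0:ℝ)..1, (dirichletKer n t : ℂ) * f (dyadicMap x t : UnitAddCircle) := by
  have hcoeff : ∀ k : ℤ, fourierCoeff (compHomeo f φ) k
      = ∫ t in (0:ℝ)..1, fourier (-k) (t : UnitAddCircle) * f (dyadicMap x t : UnitAddCircle) := by
    intro k
    rw [fourierCoeff_eq_intervalIntegral _ _ 0, div_one, one_smul, zero_add,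
      intervalIntegral.integral_of_le zero_le_one, intervalIntegral.integral_of_le zero_le_one,
      integral_Ioc_eq_integral_Ioo, integral_Ioc_eq_integral_Ioo]
    refine setIntegral_congr_fun measurableSet_Ioo fun t ht => ?_
    have h1 : compHomeo f φ (t : UnitAddCircle) = f (dyadicMap x t : UnitAddCircle) := by
      rw [compHomeo, AddCircle.liftIco_coe_apply (by simpa using ⟨ht.1.le, ht.2⟩), hφ,
        Set.projIcc_of_mem zero_le_one ⟨ht.1.le, ht.2.le⟩]
    simp only [h1, smul_eq_mul]
  have hfm : Measurable fun t => f (dyadicMap x t : UnitAddCircle) :=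
    (f.continuous.comp (AddCircle.continuous_mk' 1)).measurable.comp (measurable_dyadicMap hx)
  have hint : ∀ k : ℤ, IntervalIntegrable
      (fun t : ℝ => fourier (-k) (t : UnitAddCircle) * f (dyadicMap x t : UnitAddCircle))
      volume 0 1 := by
    intro k
    rw [intervalIntegrable_iff]
    have hc : Continuous fun t : ℝ => fourier (-k) (t : UnitAddCircle) :=
      (map_continuous _).comp (AddCircle.continuous_mk' 1)
    refine (hc.integrableOn_uIoc).mul_bdd (c := ‖f‖) hfm.aestronglyMeasurable
      (ae_of_all _ fun t => f.norm_coe_le_norm _)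
  unfold fourierPartialSum
  simp_rw [fourier_eval_zero, mul_one, hcoeff]
  rw [← intervalIntegral.integral_finsetSum fun k _ => hint k]
  refine intervalIntegral.integral_congr fun t _ => ?_
  rw [← Finset.sum_mul, sum_fourier_neg_eq_dirichletKer]

/-- For a real functional `L` of norm at most `1`, such as the real or the imaginary part, the
integrals of `L (f ∘ φ - f 0)` against the Dirichlet kernels almost surely tend to `0`. -/
lemma ae_tendsto_integral_apply (f : C(UnitAddCircle, ℂ))
    (hf : (fun δ : ℝ => f (δ : UnitAddCircle) - f 0) =o[𝓝[≠] (0 : ℝ)]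
      (fun δ : ℝ => (Real.log (Real.log (Real.log (1 / |δ|))))⁻¹))
    (L : ℂ →L[ℝ] ℝ) (hL : ∀ w, |L w| ≤ ‖w‖) :
    ∀ᵐ z ∂arrayLaw, Tendsto (fun n : ℕ => ∫ t in (0:ℝ)..1,
      L (f (dyadicMap (clampArray z) t : UnitAddCircle) - f 0) * dirichletKer n t)
      atTop (𝓝 0) := by
  set F : ℝ := ‖f‖ + ‖f 0‖ + 1 with hF
  have hF0 : 0 < F := by positivity
  set h : ℝ → ℝ := fun y => L (f (y : UnitAddCircle) - f 0) / F with hh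
  have hcont : Continuous h := by
    refine (L.continuous.comp ?_).div_const F
    exact (f.continuous.comp (AddCircle.continuous_mk' 1)).sub continuous_const
  have hh1 : ∀ y, |h y| ≤ 1 := by
    intro y
    simp only [hh]
    rw [abs_div, abs_of_pos hF0, div_le_one hF0]
    refine (hL _).trans ((norm_sub_le _ _).trans ?_)
    have := f.norm_coe_le_norm (y : UnitAddCircle)
    linarith
  have hone : ((1:ℝ) : UnitAddCircle) = 0 := AddCircle.coe_period 1
  have hle : ∀ y, ‖h y‖ ≤ F⁻¹ * ‖f (y : UnitAddCircle) - f 0‖ := by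
    intro y
    simp only [hh]
    rw [norm_div, Real.norm_of_nonneg hF0.le, div_eq_inv_mul]
    gcongr
    exact hL _
  have habs : ∀ᶠ y : ℝ in 𝓝[>] 0, |y| = y := by
    filter_upwards [self_mem_nhdsWithin] with y hy using abs_of_pos hy
  have t0 : Tendsto (fun y : ℝ => y) (𝓝[>] 0) (𝓝[≠] 0) :=
    tendsto_id.mono_right (nhdsWithin_mono 0 fun y hy => ne_of_gt hy)
  have t1 : Tendsto (fun y : ℝ => -y) (𝓝[>] 0) (𝓝[≠] 0) := by
    refine tendsto_nhdsWithin_iff.2 ⟨?_, ?_⟩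
    · have : Tendsto (fun y : ℝ => -y) (𝓝 0) (𝓝 (-0)) := tendsto_neg 0
      rw [neg_zero] at this
      exact this.mono_left nhdsWithin_le_nhds
    · filter_upwards [self_mem_nhdsWithin] with y hy
      exact neg_ne_zero.2 (ne_of_gt hy)
  have key := ae_tendsto_integral_zero_one hcont.measurable hh1 (by simp [hh]) (by simp [hh, hone])
    (by
      refine (Asymptotics.IsBigO.of_bound F⁻¹ (Eventually.of_forall hle)).trans_isLittleO
        ((hf.comp_tendsto t0).congr' EventuallyEq.rfl ?_)
      filter_upwards [habs] with y hy
      simp only [Function.comp, hy])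
    (by
      have hb : ∀ y : ℝ, ‖h (1 - y)‖ ≤ F⁻¹ * ‖f ((-y : ℝ) : UnitAddCircle) - f 0‖ := by
        intro y
        have h1 := hle (1 - y)
        rwa [sub_eq_add_neg, AddCircle.coe_add, hone, zero_add] at h1
      refine (Asymptotics.IsBigO.of_bound F⁻¹ (Eventually.of_forall hb)).trans_isLittleO
        ((hf.comp_tendsto t1).congr' EventuallyEq.rfl ?_)
      filter_upwards [habs] with y hy
      simp only [Function.comp, abs_neg, hy])
  filter_upwards [key] with z hz
  have h2 := hz.const_mul F
  rw [mul_zero] at h2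
  refine h2.congr fun n => ?_
  rw [← intervalIntegral.integral_const_mul]
  refine intervalIntegral.integral_congr fun t _ => ?_
  simp only [hh]
  field_simp

/-- The joint law of independent uniform variables is the canonical law. -/
lemma map_eq_arrayLaw {Ω : Type*} [MeasurableSpace Ω] {P : Measure Ω}
    {X : OddIndex → Ω → ℝ} (hm : ∀ i, Measurable (X i))
    (hu : ∀ i, pdf.IsUniform (X i) (Set.Icc (0 : ℝ) 1) P volume) (hX : iIndepFun X P) :
    P.map (fun ω i => X i ω) = arrayLaw := by
  rw [hX.map_fun_eq_infinitePi_map hm, arrayLaw]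
  congr 1; ext1 i
  rw [hu i, ProbabilityTheory.cond, unifLaw]
  simp

theorem theorem1 {Ω : Type*} [MeasurableSpace Ω] (P : Measure Ω) [IsProbabilityMeasure P]
    (X : ℕ → ℕ → Ω → ℝ)
    (hX_meas : ∀ n k : ℕ, Odd k → k < 2 ^ n → Measurable (X n k))
    (hX_unif : ∀ n k : ℕ, Odd k → k < 2 ^ n →
      pdf.IsUniform (X n k) (Set.Icc (0 : ℝ) 1) P volume)
    (hX_indep : iIndepFun
      (fun (i : {p : ℕ × ℕ // Odd p.2 ∧ p.2 < 2 ^ p.1}) => X i.1.1 i.1.2) P)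
    (f : C(UnitAddCircle, ℂ))
    (hf : (fun δ : ℝ => f (δ : UnitAddCircle) - f 0) =o[𝓝[≠] (0 : ℝ)]
      (fun δ : ℝ => (Real.log (Real.log (Real.log (1 / |δ|))))⁻¹)) :
    ∀ᵐ ω ∂P, ∃ φ : unitInterval ≃ₜ unitInterval,
      IsDubinsFreedman (fun n k => X n k ω) φ ∧
      Tendsto (fun n : ℕ => fourierPartialSum (compHomeo f φ) n 0) atTop (𝓝 (f 0)) := by
  have hm : ∀ i : OddIndex, Measurable (X i.1.1 i.1.2) := fun i => hX_meas _ _ i.2.1 i.2.2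
  have hlaw := map_eq_arrayLaw hm (fun i => hX_unif _ _ i.2.1 i.2.2) hX_indep
  have hre := ae_tendsto_integral_apply f hf Complex.reCLM fun w => Complex.abs_re_le_norm w
  have him := ae_tendsto_integral_apply f hf Complex.imCLM fun w => Complex.abs_im_le_norm w
  have hall := ae_clampArray_mem_Ioo.and (ae_eventually_gap_lt.and (hre.and him))
  rw [← hlaw] at hall
  filter_upwards [ae_of_ae_map (measurable_pi_iff.2 hm).aemeasurable hall]
    with ω ⟨hIoo, hgap, hre, him⟩
  set z : OddIndex → ℝ := fun i => X i.1.1 i.1.2 ω with hz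
  set x := clampArray z with hx
  have hxm : ∀ n k, x n k ∈ Set.Icc (0:ℝ) 1 := clampArray_mem z
  have hxX : ∀ n k, Odd k → k < 2 ^ n → x n k = X n k ω := by
    intro n k hk hkn
    have h1 := hIoo n k
    rw [hx, clampArray_of_index z ⟨hk, hkn⟩] at h1
    rw [hx, clampArray_of_index z ⟨hk, hkn⟩]
    -- a truncated value in the open interval `(0, 1)` has not been changed
    have h2 : 0 < z ⟨(n, k), hk, hkn⟩ := by
      have := (lt_max_iff.1 h1.1).resolve_left (lt_irrefl _)
      exact (lt_min_iff.1 this).2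
    have h3 : z ⟨(n, k), hk, hkn⟩ < 1 := by
      have := (max_lt_iff.1 h1.2).2
      exact (min_lt_iff.1 this).resolve_left (lt_irrefl _)
    rw [min_eq_right h3.le, max_eq_right h2.le]
  obtain ⟨φ, hφ⟩ := exists_homeomorph_of_gapsVanish hIoo (gapsVanish_of_eventually_lt hgap)
  refine ⟨φ, ?_, ?_⟩
  · intro n k t ht
    have hk : k ≤ 2 ^ n := by
      have h1 := t.2.2
      rw [ht, div_le_one (by positivity)] at h1
      exact_mod_cast h1
    rw [hφ, ht, dyadicMap_dyadic hxm]
    exact dyadicValue_congr hxX hk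
  · have hint : ∀ (L : ℂ →L[ℝ] ℝ) (n : ℕ), IntervalIntegrable (fun t =>
        L (f (dyadicMap x t : UnitAddCircle) - f 0) * dirichletKer n t) volume 0 1 := by
      intro L n
      rw [intervalIntegrable_iff]
      have hLm : Measurable fun t => L (f (dyadicMap x t : UnitAddCircle) - f 0) :=
        (L.continuous.comp ((f.continuous.comp (AddCircle.continuous_mk' 1)).sub
          continuous_const)).measurable.comp (measurable_dyadicMap hxm)
      refine ((continuous_dirichletKer n).integrableOn_uIoc).bdd_mul (c := ‖L‖ * (‖f‖ + ‖f 0‖))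
        hLm.aestronglyMeasurable (ae_of_all _ fun t => ?_)
      refine (L.le_opNorm _).trans ?_
      gcongr
      exact (norm_sub_le _ _).trans (add_le_add (f.norm_coe_le_norm _) le_rfl)
    have hlim := (((Complex.continuous_ofReal.tendsto 0).comp hre).add
      (((Complex.continuous_ofReal.tendsto 0).comp him).mul_const Complex.I)).const_add (f 0)
    simp only [Complex.ofReal_zero, zero_mul, add_zero] at hlim
    refine hlim.congr fun n => ?_
    rw [fourierPartialSum_compHomeo hxm f φ hφ]
    simp only [Function.comp]
    have hone : (∫ t in (0:ℝ)..1, (dirichletKer n t : ℂ) * f 0) = f 0 := by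
      rw [intervalIntegral.integral_mul_const, intervalIntegral.integral_ofReal,
        integral_dirichletKer]
      simp
    rw [← intervalIntegral.integral_ofReal, ← intervalIntegral.integral_ofReal,
      ← intervalIntegral.integral_mul_const]
    nth_rewrite 1 [← hone]
    have hintC : ∀ (L : ℂ →L[ℝ] ℝ), IntervalIntegrable (fun t =>
        ((L (f (dyadicMap x t : UnitAddCircle) - f 0) * dirichletKer n t : ℝ) : ℂ)) volume 0 1 :=
      fun L => ⟨(hint L n).1.ofReal, (hint L n).2.ofReal⟩
    have i1 := hintC Complex.reCLM
    have i2 := (hintC Complex.imCLM).mul_const Complex.I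
    have i0 : IntervalIntegrable (fun t => (dirichletKer n t : ℂ) * f 0) volume 0 1 :=
      ((Complex.continuous_ofReal.comp (continuous_dirichletKer n)).mul
        continuous_const).intervalIntegrable _ _
    rw [← intervalIntegral.integral_add i1 i2, ← intervalIntegral.integral_add i0 (i1.add i2)]
    refine intervalIntegral.integral_congr fun t _ => ?_
    have e := Complex.re_add_im (f (dyadicMap x t : UnitAddCircle) - f 0)
    simp only [Complex.reCLM_apply, Complex.imCLM_apply]
    push_cast
    linear_combination (dirichletKer n t : ℂ) * e
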